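/- **Lemma D.** Let $R$ be a commutative ring; all categories are small and $R$-linear. *Conventions.* A (non-unital) $A_\infty$-category has graded $R$-modules $\mathrm{Hom}(x,y)=\bigoplus_{k\in\mathbb Z}\mathrm{Hom}^k(x,y)$ and $R$-multilinear operations $m^n$, $n\ge 1$, of degree $2-n$ on composable sequences, such that $\sum_{m=1}^{n}\sum_{d=0}^{n-m}(-1)^{\dagger_d}\,m^{n-m+1}(f_n,\dots,f_{d+m+1},m^m(f_{d+m},\dots,f_{d+1}),f_d,\dots,f_1)=0$ with $\dagger_d=\deg f_1+\dots+\deg f_d-d$. It is strictly unital if each object $x$ has a closed degree $0$ morphism $1_x$ with $m^2(f,1_x)=f$ and $m^2(1_y,f)=(-1)^{\deg f}f$ for homogeneous $f:x\to y$, and $m^n(\dots,1_x,\dots)=0$ for $n>2$. A strict $A_\infty$-functor $F$ is a map on objects together with degree $0$ linear maps on Hom-modules commuting with all $m^n$; it is strictly unital if $F(1_x)=1_{F(x)}$. It is a quasi-equivalence if it induces quasi-isomorphisms on all Hom-complexes (with differential $m^1$) and is essentially surjective on $H^0$. It is called surjective on morphisms if it is surjective on objects and all the maps $\mathrm{Hom}(x,y)\to\mathrm{Hom}(F(x),F(y))$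 are surjective. A strictly unital $A_\infty$-category $\mathscr A$ is *semi-free* if it is the union of an increasing sequence of $A_\infty$-subcategories $\mathscr A_0\subset\mathscr A_1\subset\cdots$ with the same objects, such that 1. $\mathscr A_0$ is the discrete category: $\mathrm{Hom}_{\mathscr A_0}(x,x)=R\cdot 1_x$, with $R\to R\cdot 1_x$, $r\mapsto r1_x$, bijective, and $\mathrm{Hom}_{\mathscr A_0}(x,y)=0$ for $x\ne y$; 2. for every $n\ge1$ there is a graded subquiver $\mathscr B_n$ of $\mathscr A$ whose Hom-modules are free $R$-modules, with $m^1(\mathscr B_n)\subset\mathscr A_{n-1}$ and $\mathscr B_n\cap\mathscr A_{n-1}=0$; put $Q_n=\mathscr A_{n-1}\oplus\mathscr B_n$; 3. for every $n\ge 1$, $\mathscr A_n$ is the strictly unital $A_\infty$-category generated by the DG quiver $Q_n$ relative to $\mathscr A_{n-1}$: the canonical strict functor $\mathcal F(Q_n)\to\mathscr A$ from the free $A_\infty$-category on $Q_n$ (whose morphisms are the linear combinations of planar rooted trees with leaves labelled multilinearly by composable morphisms of $Q_n$ and whose operations $m^n$, $n\ge2$, are grafting of trees) has image $\mathscr A_n$,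 and its kernel is the $A_\infty$-ideal generated by the relations $(\bullet;m^k_{\mathscr A_{n-1}}(f_k,\dots,f_1))=m^k_{\mathcal F(Q_n)}((\bullet;f_k),\dots,(\bullet;f_1))$ for $k\ge2$ and $f_i$ in $\mathscr A_{n-1}$, together with the relations saying that the $(\bullet;1_x)$ are strict units. *Statement.* Let $\mathscr A,\mathscr B,\mathscr C$ be strictly unital $A_\infty$-categories over $R$ with $\mathscr A$ semi-free, let $F:\mathscr A\to\mathscr B$ be a strict, strictly unital $A_\infty$-functor, and let $G:\mathscr C\to\mathscr B$ be a strict quasi-equivalence that is surjective on morphisms. Then there is a (not necessarily unique) strict, strictly unital $A_\infty$-functor $\tilde F:\mathscr A\to\mathscr C$ with $G\circ\tilde F=F$. -/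

import Mathlib

noncomputable section

namespace AInf

universe u v w v' w' v'' w''

/-! ### Composable sequences -/

/-- Finite composable sequences `x = x₀ → x₁ → ⋯ → xₙ = y` of elements of a family `H` indexed by
pairs of objects; `nil` is the empty sequence and `cons f c` adds `f` at the source end.
The sequence `cons f₁ (cons f₂ …)` is written `(fₙ, …, f₂, f₁)` in the usual notation. -/
inductive Chain {α : Type v} (H : α → α → Type w) : α → α → Type (max v w)
  | nil {x : α} : Chain H x x
  | cons {x y z : α} : H x y → Chain H y z → Chain H x z

namespace Chain

variable {α : Type v} {β : Type v'} {γ : Type v''}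
  {H : α → α → Type w} {K : β → β → Type w'} {L : γ → γ → Type w''}

/-- The number of entries. -/
def length {x y : α} : Chain H x y → ℕ
  | nil => 0
  | cons _ c => c.length + 1

/-- Concatenation: first `c`, then `c'`. -/
def append {x y z : α} : Chain H x y → Chain H y z → Chain H x z
  | nil, c' => c'
  | cons f c, c' => cons f (c.append c')

/-- Sequences of length one. -/
def single {x y : α} (f : H x y) : Chain H x y := cons f nil

/-- Apply a map to all objects and all entries. -/
def map (φ : α → β) (h : ∀ {x y : α}, H x y → K (φ x) (φ y)) {x y : α} :
    Chain H x y → Chain K (φ x) (φ y)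
  | nil => nil
  | cons f c => cons (h f) (c.map φ h)

/-- All ways of writing a sequence as a concatenation `l.append r` (`n + 1` ways for a sequence of
length `n`). -/
def splits {x y : α} : Chain H x y → List (Σ z : α, Chain H x z × Chain H z y)
  | nil => [⟨x, nil, nil⟩]
  | cons f c => ⟨x, nil, cons f c⟩ :: (c.splits.map fun s => ⟨s.1, cons f s.2.1, s.2.2⟩)

theorem map_map (φ : α → β) (h : ∀ {x y : α}, H x y → K (φ x) (φ y))
    (ψ : β → γ) (k : ∀ {x y : β}, K x y → L (ψ x) (ψ y)) {x y : α} (c : Chain H x y) :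
    (c.map φ h).map ψ k = c.map (K := L) (fun a => ψ (φ a)) (fun f => k (h f)) := by
  induction c with
  | nil => rfl
  | cons f c ih => simp only [map, ih]

theorem length_append {x y z : α} (c : Chain H x y) (c' : Chain H y z) :
    (c.append c').length = c.length + c'.length := by
  induction c with
  | nil => simp only [append, length, Nat.zero_add]
  | cons f c ih => simp only [append, length, ih]; omega

theorem length_map (φ : α → β) (h : ∀ {x y : α}, H x y → K (φ x) (φ y)) {x y : α}
    (c : Chain H x y) : (c.map φ h).length = c.length := by
  induction c with
  | nil => rfl
  | cons f c ih => simp only [map, length, ih]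

end Chain

/-! ### Graded quivers and A∞-categories -/

/-- Graded `R`-linear quivers: each `Hom x y` is an `R`-module which is the internal direct sum of
its homogeneous parts `gr x y k`, `k ∈ ℤ`. -/
structure GradedQuiver (R : Type u) [CommRing R] where
  Obj : Type v
  Hom : Obj → Obj → Type v
  [addCommGroup : ∀ x y, AddCommGroup (Hom x y)]
  [module : ∀ x y, Module R (Hom x y)]
  gr : ∀ x y, ℤ → Submodule R (Hom x y)
  internal : ∀ x y, DirectSum.IsInternal (gr x y)

attribute [instance] GradedQuiver.addCommGroup GradedQuiver.module

variable {R : Type u} [CommRing R]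

/-- A family of submodules of the Hom-modules of a graded quiver (same objects). -/
abbrev SubFamily (Q : GradedQuiver.{u, v} R) := ∀ x y : Q.Obj, Submodule R (Q.Hom x y)

/-- The family is a graded subquiver: every submodule is spanned by its homogeneous elements. -/
def IsGradedSub {Q : GradedQuiver.{u, v} R} (S : SubFamily Q) : Prop :=
  ∀ x y, S x y = ⨆ k : ℤ, S x y ⊓ Q.gr x y k

/-- Homogeneous morphisms `x → y` lying in `S`, with their degree. -/
structure Homog {Q : GradedQuiver.{u, v} R} (S : SubFamily Q) (x y : Q.Obj) where
  deg : ℤ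
  val : Q.Hom x y
  mem : val ∈ S x y
  mem_gr : val ∈ Q.gr x y deg

/-- The sequence of underlying morphisms of a sequence of homogeneous morphisms. -/
def Chain.vals {Q : GradedQuiver.{u, v} R} {S : SubFamily Q} {x y : Q.Obj}
    (c : Chain (Homog S) x y) : Chain Q.Hom x y :=
  c.map (fun a => a) (fun f => f.val)

/-- The sum of the reduced degrees, `(deg f₁ - 1) + ⋯ + (deg fₙ - 1) = deg f₁ + ⋯ + deg fₙ - n`. -/
def Chain.redDeg {Q : GradedQuiver.{u, v} R} {S : SubFamily Q} {x y : Q.Obj} :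
    Chain (Homog S) x y → ℤ
  | .nil => 0
  | .cons f c => (f.deg - 1) + c.redDeg

/-- Non-unital A∞-categories over `R`. On sequences of length `n ≥ 1` the map `m` is the operation
`mⁿ`; it is `R`-multilinear of degree `2 - n`, and there is no `m⁰` (this is `m_nil`). -/
structure AInfCat (R : Type u) [CommRing R] extends GradedQuiver.{u, v} R where
  m : ∀ {x y : Obj}, Chain Hom x y → Hom x y
  m_nil : ∀ x : Obj, m (Chain.nil : Chain Hom x x) = 0
  m_add : ∀ {x y z t : Obj} (l : Chain Hom x y) (f g : Hom y z) (r : Chain Hom z t),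
    m (l.append (.cons (f + g) r)) = m (l.append (.cons f r)) + m (l.append (.cons g r))
  m_smul : ∀ {x y z t : Obj} (l : Chain Hom x y) (a : R) (f : Hom y z) (r : Chain Hom z t),
    m (l.append (.cons (a • f) r)) = a • m (l.append (.cons f r))
  m_mem_gr : ∀ {x y : Obj} (c : Chain (Homog (Q := toGradedQuiver) fun _ _ => ⊤) x y),
    m c.vals ∈ gr x y (c.redDeg + 2)
  /-- The A∞-relations
  `∑ (-1)^(deg f_d + ⋯ + deg f₁ - d) m(fₙ, …, m(f_{d+m}, …, f_{d+1}), f_d, …, f₁) = 0`.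
  The sum runs over all decompositions of a sequence of homogeneous morphisms into
  `l = (f_d, …, f₁)`, `c = (f_{d+m}, …, f_{d+1})` and `r = (fₙ, …, f_{d+m+1})`; the summands with
  `c` empty vanish. -/
  stasheff : ∀ {x y : Obj} (p : Chain (Homog (Q := toGradedQuiver) fun _ _ => ⊤) x y),
    (p.splits.map fun s =>
      (s.2.1.splits.map fun s' =>
        s'.2.1.redDeg.negOnePow •
          m (s'.2.1.vals.append (.cons (m s'.2.2.vals) s.2.2.vals))).sum).sum = 0

namespace AInfCat

/-- The differential `m¹`. -/
def d (A : AInfCat.{u, v} R) {x y : A.Obj} (f : A.Hom x y) : A.Hom x y :=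
  A.m (Chain.single f)

/-- The product `m²(g, f)` of `f : x → y` and `g : y → z`. -/
def m₂ (A : AInfCat.{u, v} R) {x y z : A.Obj} (g : A.Hom y z) (f : A.Hom x y) : A.Hom x z :=
  A.m (.cons f (.cons g .nil))

/-- The graded subquiver `S` is closed under all operations, i.e. it is an A∞-subcategory with the
same objects. -/
def IsSubcategory (A : AInfCat.{u, v} R) (S : SubFamily A.toGradedQuiver) : Prop :=
  IsGradedSub S ∧ ∀ {x y : A.Obj} (c : Chain (fun a b => ↥(S a b)) x y),
    A.m (c.map (K := A.Hom) (fun a => a) (fun f => f.1)) ∈ S x y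

end AInfCat

/-- Strictly unital A∞-categories. In the sign convention of `AInfCat.stasheff` a strict unit
satisfies `m²(f, 1) = f` and `m²(1, f) = (-1)^(deg f) f`. -/
structure StrictlyUnitalAInfCat (R : Type u) [CommRing R] extends AInfCat.{u, v} R where
  one : ∀ x : Obj, Hom x x
  one_mem_gr : ∀ x, one x ∈ gr x x 0
  d_one : ∀ x, toAInfCat.d (one x) = 0
  m₂_one : ∀ {x y : Obj} (f : Hom x y), toAInfCat.m₂ f (one x) = f
  one_m₂ : ∀ {x y : Obj} (k : ℤ) (f : Hom x y), f ∈ gr x y k →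
    toAInfCat.m₂ (one y) f = k.negOnePow • f
  m_one : ∀ {x y z : Obj} (l : Chain Hom x y) (r : Chain Hom y z), 2 ≤ l.length + r.length →
    m (l.append (.cons (one y) r)) = 0

/-! ### Strict A∞-functors -/

/-- Strict A∞-functors: the only components are the map on objects and the (degree zero, linear)
maps on morphisms, and these commute with all operations. -/
structure StrictFunctor (A : AInfCat.{u, v} R) (B : AInfCat.{u, v'} R) where
  obj : A.Obj → B.Obj
  map : ∀ {x y : A.Obj}, A.Hom x y →ₗ[R] B.Hom (obj x) (obj y)
  map_mem_gr : ∀ {x y : A.Obj} (k : ℤ) (f : A.Hom x y), f ∈ A.gr x y k →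
    map f ∈ B.gr (obj x) (obj y) k
  map_m : ∀ {x y : A.Obj} (c : Chain A.Hom x y), map (A.m c) = B.m (c.map obj (fun f => map f))

namespace StrictFunctor

/-- Composition `G ∘ F`. -/
def comp {A : AInfCat.{u, v} R} {B : AInfCat.{u, v'} R} {C : AInfCat.{u, v''} R}
    (G : StrictFunctor B C) (F : StrictFunctor A B) : StrictFunctor A C where
  obj x := G.obj (F.obj x)
  map := G.map.comp F.map
  map_mem_gr k f hf := G.map_mem_gr k _ (F.map_mem_gr k f hf)
  map_m c := by
    rw [LinearMap.comp_apply, F.map_m, G.map_m, Chain.map_map]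
    rfl

/-- The functor preserves the strict units. -/
def IsStrictlyUnital {A : StrictlyUnitalAInfCat.{u, v} R}
    {B : StrictlyUnitalAInfCat.{u, v'} R}
    (F : StrictFunctor A.toAInfCat B.toAInfCat) : Prop :=
  ∀ x, F.map (A.one x) = B.one (F.obj x)

/-- The functor is surjective on morphisms: every object of `B` (equivalently, its identity
morphism) is hit, and every morphism between objects in the image lifts to a morphism between any
given preimages of these objects. -/
def SurjectiveOnMorphisms {A : AInfCat.{u, v} R} {B : AInfCat.{u, v'} R}
    (F : StrictFunctor A B) : Prop :=
  Function.Surjective F.obj ∧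
    ∀ x y : A.Obj, Function.Surjective (F.map : A.Hom x y → B.Hom (F.obj x) (F.obj y))

/-- The maps on Hom-complexes are quasi-isomorphisms, i.e. injective (first part) and surjective
(second part) on cohomology classes. -/
def IsQuasiFullyFaithful {A : AInfCat.{u, v} R} {B : AInfCat.{u, v'} R}
    (F : StrictFunctor A B) : Prop :=
  ∀ x y : A.Obj,
    (∀ f : A.Hom x y, A.d f = 0 → (∃ h, F.map f = B.d h) → ∃ h', f = A.d h') ∧
    (∀ g : B.Hom (F.obj x) (F.obj y), B.d g = 0 → ∃ f : A.Hom x y, A.d f = 0 ∧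
      ∃ h, F.map f = g + B.d h)

end StrictFunctor

/-- Two objects are isomorphic in the cohomology category `H⁰`: there are closed morphisms of degree
zero in both directions which are mutually inverse up to boundaries. -/
def StrictlyUnitalAInfCat.IsoInH0 (B : StrictlyUnitalAInfCat.{u, v} R) (a b : B.Obj) : Prop :=
  ∃ (f : B.Hom a b) (g : B.Hom b a), f ∈ B.gr a b 0 ∧ g ∈ B.gr b a 0 ∧ B.d f = 0 ∧ B.d g = 0 ∧
    (∃ h, B.m₂ g f = B.one a + B.d h) ∧ (∃ h, B.m₂ f g = B.one b + B.d h)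

/-- Quasi-equivalences: quasi-isomorphisms on Hom-complexes, essentially surjective on `H⁰`. -/
def StrictFunctor.IsQuasiEquivalence {A : AInfCat.{u, v} R}
    {B : StrictlyUnitalAInfCat.{u, v'} R} (F : StrictFunctor A B.toAInfCat) : Prop :=
  F.IsQuasiFullyFaithful ∧ ∀ b : B.Obj, ∃ a : A.Obj, B.IsoInH0 (F.obj a) b

/-! ### Free A∞-categories and their quotients -/

/-- Planar rooted trees whose leaves are labelled by a composable sequence of elements of `L`.
`leaf ℓ` is the tree `(•; ℓ)`; `node t t' c` is the grafting of `t`, `t'` and the trees in `c`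
(so every node has at least two inputs). -/
inductive Tree {α : Type v} (L : α → α → Type w) : α → α → Type (max v w)
  | leaf {x y : α} : L x y → Tree L x y
  | node {x y z s : α} : Tree L x y → Tree L y z → Chain (Tree L) z s → Tree L x s

/-- The grafting of a composable sequence of at least two labelled trees. -/
def Tree.graft {α : Type v} {L : α → α → Type w} {x y : α} :
    (c : Chain (Tree L) x y) → 2 ≤ c.length → Tree L x y
  | .cons t (.cons t' c), _ => .node t t' c
  | .cons _ .nil, h => absurd h (by simp [Chain.length])
  | .nil, h => absurd h (by simp [Chain.length])

section Trees

variable {A : AInfCat.{u, v} R} {Q : SubFamily A.toGradedQuiver}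

mutual
/-- The value in `A` of a tree labelled by morphisms of `A`: every node with `n` inputs is
interpreted as `mⁿ`. -/
def Tree.eval {x y : A.Obj} : Tree (Homog Q) x y → A.Hom x y
  | .leaf f => f.val
  | .node t t' c => A.m (.cons t.eval (.cons t'.eval (Tree.evalChain c)))
/-- Evaluation of all trees of a sequence. -/
def Tree.evalChain {x y : A.Obj} : Chain (Tree (Homog Q)) x y → Chain A.Hom x y
  | .nil => .nil
  | .cons t c => .cons t.eval (Tree.evalChain c)
end

mutual
/-- The degree of a labelled tree, a node with `n` inputs having degree `2 - n`. -/
def Tree.deg {x y : A.Obj} : Tree (Homog Q) x y → ℤ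
  | .leaf f => f.deg
  | .node t t' c => (t.deg - 1) + (t'.deg - 1) + Tree.redDegChain c + 2
/-- The sum of the reduced degrees of the trees of a sequence. -/
def Tree.redDegChain {x y : A.Obj} : Chain (Tree (Homog Q)) x y → ℤ
  | .nil => 0
  | .cons t c => (t.deg - 1) + Tree.redDegChain c
end

/-- The linear extension of `Tree.eval` to formal linear combinations of labelled trees. This is
the canonical strict functor from the free A∞-category on `Q` to `A`. -/
def evalLin (Q : SubFamily A.toGradedQuiver) (x y : A.Obj) :
    (Tree (Homog Q) x y →₀ R) →ₗ[R] A.Hom x y :=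
  Finsupp.linearCombination R Tree.eval

end Trees

/-- The formal linear combinations of labelled trees that vanish in the strictly unital A∞-category
generated by the DG quiver `Q` relative to the subcategory `S ⊆ Q`.

The constructors `add` and `smul` (with the closure properties) give multilinearity of a tree in its
labels: modulo these, the combinations of trees form the free A∞-category `F(Q)`, whose
Hom-modules are `⨁_{trees} Q ⊗ ⋯ ⊗ Q` and whose operations `mⁿ`, `n ≥ 2`, are grafting.
`rel` are the relations `(•; mⁿ(fₙ, …, f₁)) = mⁿ((•; fₙ), …, (•; f₁))` for `fᵢ` in `S`, and
`one_right`, `one_left`, `one_higher` say that the units of `A` are strict units of the quotient.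
The last four constructors say that we take the A∞-ideal generated by these relations. The
differential `m¹` of the quotient is determined by that of `Q` and by the A∞-relations. -/
inductive FreeRel (A : StrictlyUnitalAInfCat.{u, v} R) (S Q : SubFamily A.toGradedQuiver) :
    ∀ {x y : A.Obj}, (Tree (Homog Q) x y →₀ R) → Prop
  | add {x y : A.Obj} (f g h : Homog Q x y) (hf : f.deg = h.deg) (hg : g.deg = h.deg)
      (hv : h.val = f.val + g.val) :
      FreeRel A S Q (Finsupp.single (.leaf h) 1 - Finsupp.single (.leaf f) 1
        - Finsupp.single (.leaf g) 1)
  | smul {x y : A.Obj} (a : R) (f h : Homog Q x y) (hf : f.deg = h.deg)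
      (hv : h.val = a • f.val) :
      FreeRel A S Q (Finsupp.single (.leaf h) 1 - Finsupp.single (.leaf f) a)
  | rel {x y : A.Obj} (c : Chain (Homog Q) x y) (hc : 2 ≤ c.length)
      (c' : Chain (Homog S) x y) (hcc' : c.vals = c'.vals) (hdeg : c.redDeg = c'.redDeg)
      (h : Homog Q x y) (hd : h.deg = c.redDeg + 2) (hv : h.val = A.m c.vals) :
      FreeRel A S Q (Finsupp.single (.leaf h) 1 -
        Finsupp.single (Tree.graft (c.map (K := Tree (Homog Q)) (fun a => a) (fun f => .leaf f))
          (by rw [Chain.length_map]; exact hc)) 1)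
  | one_right {x y : A.Obj} (t : Tree (Homog Q) x y) (e : Homog Q x x) (hd : e.deg = 0)
      (he : e.val = A.one x) :
      FreeRel A S Q (Finsupp.single (.node (.leaf e) t .nil) 1 - Finsupp.single t 1)
  | one_left {x y : A.Obj} (t : Tree (Homog Q) x y) (e : Homog Q y y) (hd : e.deg = 0)
      (he : e.val = A.one y) :
      FreeRel A S Q (Finsupp.single (.node t (.leaf e) .nil) 1 -
        t.deg.negOnePow • Finsupp.single t 1)
  | one_higher {x y z : A.Obj} (l : Chain (Tree (Homog Q)) x y) (e : Homog Q y y)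
      (r : Chain (Tree (Homog Q)) y z) (h : 2 ≤ l.length + r.length) (hd : e.deg = 0)
      (he : e.val = A.one y) :
      FreeRel A S Q (Finsupp.single (Tree.graft (l.append (.cons (.leaf e) r))
        (by rw [Chain.length_append]; simp only [Chain.length]; omega)) 1)
  | zero_mem {x y : A.Obj} : FreeRel A S Q (0 : Tree (Homog Q) x y →₀ R)
  | add_mem {x y : A.Obj} (a b : Tree (Homog Q) x y →₀ R) :
      FreeRel A S Q a → FreeRel A S Q b → FreeRel A S Q (a + b)
  | smul_mem {x y : A.Obj} (r : R) (a : Tree (Homog Q) x y →₀ R) :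
      FreeRel A S Q a → FreeRel A S Q (r • a)
  | graft_mem {x y z s : A.Obj} (l : Chain (Tree (Homog Q)) x y)
      (a : Tree (Homog Q) y z →₀ R) (r : Chain (Tree (Homog Q)) z s)
      (h : 1 ≤ l.length + r.length) :
      FreeRel A S Q a →
      FreeRel A S Q (a.mapDomain fun t => Tree.graft (l.append (.cons t r))
        (by rw [Chain.length_append]; simp only [Chain.length]; omega))

/-! ### Semi-free A∞-categories -/

/-- The image in `A` of the discrete category on the objects of `A`: the multiples of the units. -/
def unitSpan (A : StrictlyUnitalAInfCat.{u, v} R) : SubFamily A.toGradedQuiver :=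
  fun x y => Submodule.span R {f | ∃ h : x = y, f = h ▸ A.one x}

/-- A filtration `A₀ ⊆ Q₁ ⊆ A₁ ⊆ Q₂ ⊆ ⋯` exhibiting the strictly unital A∞-category `A` as semi-free
(over the discrete category on its objects); here `Aₙ` is `stage n` and
`Qₙ₊₁ = stage n ⊕ gen n`. -/
structure SemiFreeFiltration (A : StrictlyUnitalAInfCat.{u, v} R) where
  stage : ℕ → SubFamily A.toGradedQuiver
  gen : ℕ → SubFamily A.toGradedQuiver
  /-- The stages are A∞-subcategories with the objects of `A`. -/
  stage_sub : ∀ n, A.IsSubcategory (stage n)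
  /-- Their union is `A`. -/
  exhaust : ∀ (x y : A.Obj) (f : A.Hom x y), ∃ n, f ∈ stage n x y
  /-- The discrete category on the objects of `A`, with endomorphisms `R · 1ₓ ≅ R`, is mapped
  isomorphically onto the first stage. -/
  stage_zero : stage 0 = unitSpan A
  one_free : ∀ (x : A.Obj) (a : R), a • A.one x = 0 → a = 0
  /-- `Qₙ₊₁` is the direct sum of `Aₙ` and the graded quiver `gen n`. -/
  gen_graded : ∀ n, IsGradedSub (gen n)
  disjoint : ∀ n x y, Disjoint (stage n x y) (gen n x y)
  /-- `Qₙ₊₁ / Aₙ` has free Hom-modules and zero differential. -/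
  gen_free : ∀ n x y, Module.Free R (gen n x y)
  d_gen : ∀ n x y (f : A.Hom x y), f ∈ gen n x y → A.d f ∈ stage n x y
  /-- The canonical functor from the free A∞-category on `Qₙ₊₁` to `A` has image `Aₙ₊₁` … -/
  range_eval : ∀ n x y,
    LinearMap.range (evalLin (A := A.toAInfCat) (fun a b => stage n a b ⊔ gen n a b) x y) =
      stage (n + 1) x y
  /-- … and its kernel is the A∞-ideal generated by the relations that hold in `Aₙ` and by the
  relations for strict units. -/
  ker_eval : ∀ n x y (a : Tree (Homog fun a b => stage n a b ⊔ gen n a b) x y →₀ R),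
    evalLin (A := A.toAInfCat) _ x y a = 0 → FreeRel A (stage n) _ a

/-- Semi-free A∞-categories. -/
def IsSemiFree (A : StrictlyUnitalAInfCat.{u, v} R) : Prop := Nonempty (SemiFreeFiltration A)

end AInf

end

universe u v₁ v₂ v₃

-- The lift is built along the filtration, as one extends a map along a cofibration against an
-- acyclic fibration. Surjectivity of `G` on objects gives a map `o` on objects through which that
-- of `F` factors. On the discrete category the lift is forced by the units; it lies over `F`
-- because a strict functor that is surjective on endomorphisms preserves strict units
-- (`StrictFunctor.map_one_of_surjective`).
--
-- Suppose a lift `φ` is given on one stage. A new generator `f` has to go to some `c` with `d c = φ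
-- (d f)` and `G c = F f`. Now `φ (d f)` is a cycle whose image under `G` is the boundary `d (F f)`,
-- and for a surjective quasi-isomorphism such a `c` exists
-- (`StrictFunctor.exists_d_eq_and_map_eq`). Freeness of the generators makes the choice linear, and
-- taking a homogeneous part makes it of degree zero (`exists_lift_generators`).
--
-- The resulting map of DG quivers is extended to labelled trees by reading every node as an
-- operation of `C`. It kills the defining relations (`FreeRel.liftLin_eq_zero`), hence descends to
-- the next stage (`exists_isFunctorLift_of_generated`). Compatibility with the operations of at
-- least two inputs comes from grafting. The differential is not part of the tree structure:
-- compatibility with it follows by induction on trees from the A∞-relations of `A` and `C`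
-- (`map_d_m`). Each lift restricts to the previous one, so they glue on the union
-- (`SemiFreeFiltration.exists_isFunctorLift_top`).
--
-- Partial lifts are plain functions on the whole Hom-sets, constrained only on a subfamily, so that
-- lifts on different stages can be compared directly.

noncomputable section

namespace AInf

universe v w v' w' v'' w''

-- Composable sequences: predicates on entries, concatenation, splittings.

namespace Chain

variable {α : Type v} {β : Type v'} {γ : Type v''}
  {H : α → α → Type w} {K : β → β → Type w'} {L : γ → γ → Type w''}

/-- Every entry of the sequence satisfies `P`. -/
def All (P : ∀ x y : α, H x y → Prop) {x y : α} : Chain H x y → Prop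
  | nil => True
  | cons f c => P _ _ f ∧ c.All P

/-- The sum of `dg f - 1` over the entries `f` of a sequence. -/
def degSum (dg : ∀ x y : α, H x y → ℤ) {x y : α} : Chain H x y → ℤ
  | nil => 0
  | cons f c => (dg _ _ f - 1) + c.degSum dg

theorem All.mono {P P' : ∀ x y : α, H x y → Prop} (h : ∀ x y f, P x y f → P' x y f)
    {x y : α} {c : Chain H x y} (hc : c.All P) : c.All P' := by
  induction c with
  | nil => trivial
  | cons f c ih => exact ⟨h _ _ _ hc.1, ih hc.2⟩

theorem all_of_forall {P : ∀ x y : α, H x y → Prop} (h : ∀ x y f, P x y f)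
    {x y : α} (c : Chain H x y) : c.All P := by
  induction c with
  | nil => trivial
  | cons f c ih => exact ⟨h _ _ _, ih⟩

theorem all_append {P : ∀ x y : α, H x y → Prop} {x y z : α} {c : Chain H x y}
    {c' : Chain H y z} : (c.append c').All P ↔ c.All P ∧ c'.All P := by
  induction c with
  | nil => simp [append, All]
  | cons f c ih => simp [append, All, ih, and_assoc]

theorem all_map {P : ∀ x y : β, K x y → Prop} (φ : α → β)
    (h : ∀ {x y : α}, H x y → K (φ x) (φ y)) {x y : α} {c : Chain H x y} :
    (c.map φ h).All P ↔ c.All fun _ _ f => P _ _ (h f) := by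
  induction c with
  | nil => rfl
  | cons f c ih => simp [map, All, ih]

theorem map_append (φ : α → β) (h : ∀ {x y : α}, H x y → K (φ x) (φ y)) {x y z : α}
    (c : Chain H x y) (c' : Chain H y z) :
    (c.append c').map φ h = (c.map (K := K) φ h).append (c'.map φ h) := by
  induction c with
  | nil => rfl
  | cons f c ih => simp only [append, map, ih]

theorem append_nil {x y : α} (c : Chain H x y) : c.append nil = c := by
  induction c with
  | nil => rfl
  | cons f c ih => simp only [append, ih]

theorem append_assoc {x y z t : α} (c : Chain H x y) (c' : Chain H y z) (c'' : Chain H z t) :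
    (c.append c').append c'' = c.append (c'.append c'') := by
  induction c with
  | nil => rfl
  | cons f c ih => simp only [append, ih]

theorem map_congr {φ : α → β} {h k : ∀ {x y : α}, H x y → K (φ x) (φ y)} {x y : α}
    {c : Chain H x y} (hc : c.All fun _ _ f => h f = k f) :
    c.map φ (K := K) h = c.map φ k := by
  induction c with
  | nil => rfl
  | cons f c ih => simp only [map, hc.1, ih hc.2]

theorem splits_map (φ : α → β) (h : ∀ {x y : α}, H x y → K (φ x) (φ y)) {x y : α}
    (c : Chain H x y) :
    (c.map (K := K) φ h).splits =
      c.splits.map fun s => ⟨φ s.1, s.2.1.map φ h, s.2.2.map φ h⟩ := by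
  induction c with
  | nil => rfl
  | cons f c ih => simp [map, splits, ih, Function.comp_def]

theorem append_of_mem_splits {x y : α} {c : Chain H x y} {s} (hs : s ∈ c.splits) :
    s.2.1.append s.2.2 = c := by
  induction c with
  | nil =>
    simp only [splits, List.mem_singleton] at hs
    subst hs; rfl
  | cons f c ih =>
    simp only [splits, List.mem_cons, List.mem_map] at hs
    rcases hs with rfl | ⟨s, hs, rfl⟩
    · rfl
    · simp only [append, ih hs]

theorem right_mem_splits {x y : α} (c : Chain H x y) :
    (⟨y, c, nil⟩ : Σ z : α, Chain H x z × Chain H z y) ∈ c.splits := by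
  induction c with
  | nil => simp [splits]
  | cons f c ih => exact List.mem_cons_of_mem _ (List.mem_map_of_mem (f := fun s :
      (Σ z : α, Chain H _ z × Chain H z _) => (⟨s.1, cons f s.2.1, s.2.2⟩ :
      Σ z : α, Chain H _ z × Chain H z _)) ih)

/-- Together with `sum_splits_of_left`, this isolates in the double sum of an A∞-relation the
summand whose inner operation takes the entire sequence. -/
theorem sum_splits_of_right {M : Type*} [AddCommMonoid M] {x y : α} (c : Chain H x y)
    (f : (Σ z : α, Chain H x z × Chain H z y) → M)
    (hf : ∀ s ∈ c.splits, s.2.2.length ≠ 0 → f s = 0) :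
    (c.splits.map f).sum = f ⟨y, c, nil⟩ := by
  induction c with
  | nil => simp [splits]
  | cons g c ih =>
    simp only [splits, List.map_cons, List.sum_cons, List.map_map]
    rw [hf _ (by simp [splits]) (by simp [length]), zero_add]
    exact ih (fun s => f ⟨s.1, cons g s.2.1, s.2.2⟩) fun s hs h =>
      hf _ (List.mem_cons_of_mem _ (List.mem_map_of_mem hs)) h

theorem sum_splits_of_left {M : Type*} [AddCommMonoid M] {x y : α} (c : Chain H x y)
    (f : (Σ z : α, Chain H x z × Chain H z y) → M)
    (hf : ∀ s ∈ c.splits, s.2.1.length ≠ 0 → f s = 0) :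
    (c.splits.map f).sum = f ⟨x, nil, c⟩ := by
  cases c with
  | nil => simp [splits]
  | cons g c =>
    simp only [splits, List.map_cons, List.sum_cons, List.map_map]
    rw [List.sum_eq_zero, add_zero]
    intro a ha
    obtain ⟨s, hs, rfl⟩ := List.mem_map.1 ha
    exact hf _ (List.mem_cons_of_mem _ (List.mem_map_of_mem hs)) (by simp [length])

end Chain

-- Induction on planar trees.

namespace Tree

variable {α : Type v} {L : α → α → Type w}

mutual
-- The constructor `node` separates two subtrees from a nested sequence of trees. Treating all
-- inputs of a node as one sequence lets inductions use the operations of all arities uniformly.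
theorem graftInduction {motive : ∀ x y : α, Tree L x y → Prop}
    (leaf : ∀ x y (f : L x y), motive x y (.leaf f))
    (graft : ∀ x y (c : Chain (Tree L) x y) (h : 2 ≤ c.length), c.All motive →
      motive x y (Tree.graft c h)) {x y : α} : ∀ t : Tree L x y, motive x y t
  | .leaf f => leaf _ _ f
  | .node t t' c => graft _ _ (.cons t (.cons t' c)) (by simp [Chain.length])
      ⟨graftInduction leaf graft t, graftInduction leaf graft t',
        graftInductionChain leaf graft c⟩
theorem graftInductionChain {motive : ∀ x y : α, Tree L x y → Prop}
    (leaf : ∀ x y (f : L x y), motive x y (.leaf f))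
    (graft : ∀ x y (c : Chain (Tree L) x y) (h : 2 ≤ c.length), c.All motive →
      motive x y (Tree.graft c h)) {x y : α} : ∀ c : Chain (Tree L) x y, c.All motive
  | .nil => trivial
  | .cons t c => ⟨graftInduction leaf graft t, graftInductionChain leaf graft c⟩
end

end Tree

variable {R : Type u} [CommRing R]

-- Homogeneous components and graded subquivers.

namespace GradedQuiver

variable (Q : GradedQuiver.{u, v} R) {x y : Q.Obj}

theorem bijective_coeLinearMap (x y : Q.Obj) :
    Function.Bijective (DirectSum.coeLinearMap (Q.gr x y)) :=
  Q.internal x y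

/-- The decomposition of morphisms into homogeneous components. -/
def decomposition (x y : Q.Obj) : (DirectSum ℤ fun k => Q.gr x y k) ≃ₗ[R] Q.Hom x y :=
  LinearEquiv.ofBijective (DirectSum.coeLinearMap (Q.gr x y)) (Q.bijective_coeLinearMap x y)

/-- The homogeneous component of degree `k`. -/
def proj (x y : Q.Obj) (k : ℤ) : Q.Hom x y →ₗ[R] Q.Hom x y :=
  (Q.gr x y k).subtype ∘ₗ DirectSum.component R ℤ (fun k => Q.gr x y k) k ∘ₗ
    (Q.decomposition x y).symm.toLinearMap

theorem proj_mem (k : ℤ) (f : Q.Hom x y) : Q.proj x y k f ∈ Q.gr x y k :=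
  Subtype.mem _

theorem decomposition_symm_coe {j : ℤ} {f : Q.Hom x y} (hf : f ∈ Q.gr x y j) :
    (Q.decomposition x y).symm f = DirectSum.lof R ℤ (fun k => Q.gr x y k) j ⟨f, hf⟩ := by
  rw [LinearEquiv.symm_apply_eq]
  exact (DirectSum.coeLinearMap_lof (Q.gr x y) j ⟨f, hf⟩).symm

theorem proj_same {k : ℤ} {f : Q.Hom x y} (hf : f ∈ Q.gr x y k) : Q.proj x y k f = f := by
  simp [proj, Q.decomposition_symm_coe hf, DirectSum.component.lof_self]

theorem proj_of_ne {j k : ℤ} (hjk : j ≠ k) {f : Q.Hom x y} (hf : f ∈ Q.gr x y j) :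
    Q.proj x y k f = 0 := by
  simp [proj, Q.decomposition_symm_coe hf, DirectSum.component.of, hjk]

theorem gr_induction {p : Q.Hom x y → Prop} (hom : ∀ k, ∀ f ∈ Q.gr x y k, p f) (zero : p 0)
    (add : ∀ f g, p f → p g → p (f + g)) (f : Q.Hom x y) : p f :=
  Submodule.iSup_induction (Q.gr x y) (motive := p)
    (by rw [(Q.internal x y).submodule_iSup_eq_top]; trivial) hom zero add

theorem finite_proj_ne_zero (f : Q.Hom x y) : {k | Q.proj x y k f ≠ 0}.Finite := by
  induction f using Q.gr_induction with
  | hom k f hf =>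
    refine (Set.finite_singleton k).subset fun j hj => ?_
    by_contra h
    exact hj (Q.proj_of_ne (Ne.symm h) hf)
  | zero => simp
  | add f g hf hg =>
    refine (hf.union hg).subset fun k hk => ?_
    by_contra h
    simp only [Set.mem_union, Set.mem_ofPred_eq, not_or, not_not] at h
    exact hk (by rw [map_add, h.1, h.2, add_zero])

/-- Applied to the differential (`s = 1`) and to a strict functor (`s = 0`), this shows that
equations involving them survive passage to the degree zero part of a linear map. -/
theorem proj_comm {Q' : GradedQuiver.{u, v'} R} {x' y' : Q'.Obj} (s : ℤ)
    (T : Q.Hom x y →ₗ[R] Q'.Hom x' y') (hT : ∀ k, ∀ f ∈ Q.gr x y k, T f ∈ Q'.gr x' y' (k + s))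
    (k : ℤ) (f : Q.Hom x y) : T (Q.proj x y k f) = Q'.proj x' y' (k + s) (T f) := by
  induction f using Q.gr_induction with
  | hom j f hf =>
    by_cases h : j = k
    · subst h
      rw [Q.proj_same hf, Q'.proj_same (hT _ _ hf)]
    · rw [Q.proj_of_ne h hf, Q'.proj_of_ne (by simpa using h) (hT _ _ hf), map_zero]
  | zero => simp
  | add f g hf hg => simp [hf, hg]

end GradedQuiver

section Graded

variable {Q : GradedQuiver.{u, v} R} {S S' : SubFamily Q}

theorem IsGradedSub.induction (hS : IsGradedSub S) {x y : Q.Obj} {p : Q.Hom x y → Prop}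
    (hom : ∀ k, ∀ f ∈ S x y, f ∈ Q.gr x y k → p f) (zero : p 0)
    (add : ∀ f ∈ S x y, ∀ g ∈ S x y, p f → p g → p (f + g)) {f : Q.Hom x y} (hf : f ∈ S x y) :
    p f := by
  have key : f ∈ S x y ∧ p f := by
    rw [hS x y] at hf
    refine Submodule.iSup_induction _ (motive := fun f => f ∈ S x y ∧ p f) hf
      (fun k f hf => ⟨hf.1, hom k f hf.1 hf.2⟩) ⟨zero_mem _, zero⟩
      fun f g hf hg => ⟨add_mem hf.1 hg.1, add f hf.1 g hg.1 hf.2 hg.2⟩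
  exact key.2

theorem IsGradedSub.proj_mem (hS : IsGradedSub S) {x y : Q.Obj} {f : Q.Hom x y}
    (hf : f ∈ S x y) (k : ℤ) : Q.proj x y k f ∈ S x y := by
  refine hS.induction (p := fun f => Q.proj x y k f ∈ S x y) (fun j f hf hj => ?_) (by simp)
    (fun f _ g _ h h' => by rw [map_add]; exact add_mem h h') hf
  by_cases h : j = k
  · subst h
    rwa [Q.proj_same hj]
  · rw [Q.proj_of_ne h hj]
    exact zero_mem _

theorem IsGradedSub.sup (hS : IsGradedSub S) (hS' : IsGradedSub S') :
    IsGradedSub fun x y => S x y ⊔ S' x y := by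
  intro x y
  apply le_antisymm
  · refine sup_le ?_ ?_
    · conv_lhs => rw [hS x y]
      exact iSup_mono fun k => inf_le_inf_right _ le_sup_left
    · conv_lhs => rw [hS' x y]
      exact iSup_mono fun k => inf_le_inf_right _ le_sup_right
  · exact iSup_le fun k => inf_le_left

theorem Chain.all_vals {x y : Q.Obj} (c : Chain (Homog S) x y) :
    c.vals.All fun x y f => f ∈ S x y := by
  rw [vals, Chain.all_map]
  exact Chain.all_of_forall (fun _ _ f => f.mem) c

end Graded

-- Multilinearity, the A∞-relations for labelled sequences, and `d ∘ d = 0`.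

namespace AInfCat

variable (A : AInfCat.{u, v} R)

/-- The operations are linear in each entry. -/
def slot {x y z t : A.Obj} (l : Chain A.Hom x y) (r : Chain A.Hom z t) :
    A.Hom y z →ₗ[R] A.Hom x t where
  toFun f := A.m (l.append (.cons f r))
  map_add' f g := A.m_add l f g r
  map_smul' a f := A.m_smul l a f r

theorem slot_apply {x y z t : A.Obj} (l : Chain A.Hom x y) (r : Chain A.Hom z t)
    (f : A.Hom y z) : A.slot l r f = A.m (l.append (.cons f r)) := rfl

/-- The differential as a linear map. -/
def dLin (x y : A.Obj) : A.Hom x y →ₗ[R] A.Hom x y := A.slot .nil .nil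

theorem dLin_apply {x y : A.Obj} (f : A.Hom x y) : A.dLin x y f = A.d f := rfl

theorem d_add {x y : A.Obj} (f g : A.Hom x y) : A.d (f + g) = A.d f + A.d g :=
  map_add (A.dLin x y) f g

theorem d_sub {x y : A.Obj} (f g : A.Hom x y) : A.d (f - g) = A.d f - A.d g :=
  map_sub (A.dLin x y) f g

section Labels

variable {α : Type v'} {L : α → α → Type w} (o : α → A.Obj)
  (h : ∀ {x y : α}, L x y → A.Hom (o x) (o y)) (dg : ∀ x y : α, L x y → ℤ)

theorem m_map_mem_gr {x y : α} {c : Chain L x y}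
    (hc : c.All fun x y f => h f ∈ A.gr (o x) (o y) (dg x y f)) :
    A.m (c.map o h) ∈ A.gr (o x) (o y) (c.degSum dg + 2) := by
  have key : ∃ p : Chain (Homog (Q := A.toGradedQuiver) fun _ _ => ⊤) (o x) (o y),
      p.vals = c.map o h ∧ p.redDeg = c.degSum dg := by
    induction c with
    | nil => exact ⟨.nil, rfl, rfl⟩
    | cons f c ih =>
      obtain ⟨p, hp, hp'⟩ := ih hc.2
      refine ⟨.cons ⟨_, h f, trivial, hc.1⟩ p, ?_, ?_⟩
      · rw [Chain.map, ← hp]; rfl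
      · rw [Chain.degSum, ← hp']; rfl
  obtain ⟨p, hp, hp'⟩ := key
  rw [← hp, ← hp']
  exact A.m_mem_gr p

/-- Indexing by abstract labels with prescribed degrees lets one sequence, later a sequence of
trees, produce the relations in `A` and in `C` with the same splittings and the same signs. -/
theorem stasheff_map (hg : ∀ x y (f : L x y), h f ∈ A.gr (o x) (o y) (dg x y f)) {x y : α}
    (p : Chain L x y) :
    (p.splits.map fun s =>
      (s.2.1.splits.map fun s' =>
        (s'.2.1.degSum dg).negOnePow •
          A.m ((s'.2.1.map o h).append
            (.cons (A.m (s'.2.2.map o h)) (s.2.2.map o h)))).sum).sum = 0 := by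
  let H : ∀ {x y : α}, L x y → Homog (Q := A.toGradedQuiver) (fun _ _ => ⊤) (o x) (o y) :=
    fun {x y} f => ⟨dg x y f, h f, trivial, hg x y f⟩
  have hv : ∀ {x y : α} (c : Chain L x y), (c.map o H).vals = c.map o h := fun c =>
    Chain.map_map _ _ _ _ c
  have hd : ∀ {x y : α} (c : Chain L x y), (c.map o H).redDeg = c.degSum dg := fun c => by
    induction c with
    | nil => rfl
    | cons f c ih => rw [Chain.map, Chain.redDeg, ih, Chain.degSum]
  have := A.stasheff (p.map o H)
  simpa only [Chain.splits_map, List.map_map, Function.comp_def, hv, hd] using this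

end Labels

variable {A}

theorem d_mem_gr {x y : A.Obj} {k : ℤ} {f : A.Hom x y} (hf : f ∈ A.gr x y k) :
    A.d f ∈ A.gr x y (k + 1) := by
  have := A.m_mem_gr (.cons ⟨k, f, trivial, hf⟩ .nil)
  have e : Chain.redDeg (.cons ⟨k, f, trivial, hf⟩ .nil :
      Chain (Homog (Q := A.toGradedQuiver) fun _ _ => ⊤) x y) + 2 = k + 1 := by
    simp only [Chain.redDeg]; ring
  rwa [e] at this

theorem d_d {x y : A.Obj} (f : A.Hom x y) : A.d (A.d f) = 0 := by
  induction f using A.gr_induction with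
  | hom k f hf =>
    have := A.stasheff (.cons ⟨k, f, trivial, hf⟩ .nil)
    simp [Chain.splits, Chain.vals, Chain.map, Chain.append, Chain.redDeg, A.m_nil] at this
    -- The summands with empty inner sequence insert `m⁰ = 0` next to `f`; they vanish by linearity
    -- and leave only `d (d f)`.
    have h1 : ∀ z, A.m (Chain.cons f (Chain.cons (0 : A.Hom y z) .nil)) = 0 := fun z =>
      map_zero (A.slot (Chain.cons f .nil) .nil)
    have h2 : ∀ z, A.m (Chain.cons (0 : A.Hom z x) (Chain.cons f .nil)) = 0 := fun z =>
      map_zero (A.slot .nil (Chain.cons f .nil))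
    simpa [h1, h2, d, Chain.single] using this
  | zero => simp [← dLin_apply]
  | add f g hf hg => rw [d_add, d_add, hf, hg, add_zero]

theorem IsSubcategory.m_mem {S : SubFamily A.toGradedQuiver} (hS : A.IsSubcategory S)
    {x y : A.Obj} {c : Chain A.Hom x y} (hc : c.All fun x y f => f ∈ S x y) :
    A.m c ∈ S x y := by
  have key : ∃ p : Chain (fun a b => ↥(S a b)) x y,
      p.map (K := A.Hom) (fun a => a) (fun f => f.1) = c := by
    induction c with
    | nil => exact ⟨.nil, rfl⟩
    | cons f c ih =>
      obtain ⟨p, hp⟩ := ih hc.2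
      exact ⟨.cons ⟨f, hc.1⟩ p, by rw [Chain.map, hp]⟩
  obtain ⟨p, rfl⟩ := key
  exact hS.2 p

end AInfCat

-- Surjective quasi-isomorphisms and homogeneous parts of linear maps.

/-- The strict A∞-functors with prescribed map on objects. -/
structure FunctorOver (A : AInfCat.{u, v} R) (B : AInfCat.{u, v'} R) (o : A.Obj → B.Obj) where
  map : ∀ {x y : A.Obj}, A.Hom x y →ₗ[R] B.Hom (o x) (o y)
  map_mem_gr : ∀ {x y : A.Obj} (k : ℤ) (f : A.Hom x y), f ∈ A.gr x y k →
    map f ∈ B.gr (o x) (o y) k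
  map_m : ∀ {x y : A.Obj} (c : Chain A.Hom x y), map (A.m c) = B.m (c.map o (fun f => map f))

theorem FunctorOver.map_d {A : AInfCat.{u, v} R} {B : AInfCat.{u, v'} R} {o : A.Obj → B.Obj}
    (F : FunctorOver A B o) {x y : A.Obj} (f : A.Hom x y) : F.map (A.d f) = B.d (F.map f) :=
  F.map_m _

theorem StrictFunctor.map_d {A : AInfCat.{u, v} R} {B : AInfCat.{u, v'} R}
    (F : StrictFunctor A B) {x y : A.Obj} (f : A.Hom x y) : F.map (A.d f) = B.d (F.map f) :=
  F.map_m _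

/-- A quasi-isomorphism which is surjective has the lifting property for the inclusion of a cycle
into its cone. -/
theorem StrictFunctor.exists_d_eq_and_map_eq {C : AInfCat.{u, v} R} {B : AInfCat.{u, v'} R}
    {G : StrictFunctor C B} (hG : G.IsQuasiFullyFaithful) (hGs : G.SurjectiveOnMorphisms)
    {x y : C.Obj} (z : C.Hom x y) (hz : C.d z = 0) (b : B.Hom (G.obj x) (G.obj y))
    (hb : G.map z = B.d b) : ∃ c : C.Hom x y, C.d c = z ∧ G.map c = b := by
  -- Injectivity on cohomology gives a primitive `c` of `z`, possibly with the wrong image under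
  -- `G`.
  obtain ⟨c, hc⟩ := (hG x y).1 z hz ⟨b, hb⟩
  -- The error `b - G c` is a cycle, so surjectivity on cohomology lifts it to a cycle `f` up to a
  -- boundary `d h`. A preimage `k` of `h` removes that boundary without changing the differential.
  obtain ⟨f, hf, h, hh⟩ := (hG x y).2 (b - G.map c) (by
    rw [B.d_sub, ← G.map_d, ← hc, hb, sub_self])
  obtain ⟨k, hk⟩ := hGs.2 x y h
  refine ⟨c + f - C.d k, ?_, ?_⟩
  · rw [C.d_sub, C.d_add, hf, AInfCat.d_d, ← hc]; simp
  · rw [map_sub, map_add, hh, G.map_d, hk]; abel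

/-- Every linear map between graded modules has a homogeneous part of degree zero. -/
theorem IsGradedSub.exists_homogenization {Q : GradedQuiver.{u, v} R} {W : SubFamily Q}
    (hW : IsGradedSub W) {Q' : GradedQuiver.{u, v'} R} {x y : Q.Obj} {x' y' : Q'.Obj}
    (L : W x y →ₗ[R] Q'.Hom x' y') :
    ∃ β : W x y →ₗ[R] Q'.Hom x' y', ∀ k (f : W x y), f.1 ∈ Q.gr x y k →
      β f = Q'.proj x' y' k (L f) := by
  let P : ℤ → W x y →ₗ[R] W x y := fun k =>
    (Q.proj x y k).restrict fun f hf => hW.proj_mem hf k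
  -- The degree zero part of `L` is the sum over `k` of its components from degree `k` to degree
  -- `k`; on each element only finitely many terms are nonzero.
  let N : ℤ → W x y →ₗ[R] Q'.Hom x' y' := fun k => Q'.proj _ _ k ∘ₗ L ∘ₗ P k
  have hfin : ∀ f : W x y, (Function.support fun k => N k f).Finite := fun f => by
    refine (Q.finite_proj_ne_zero f.1).subset fun k hk hk' => hk ?_
    have : P k f = 0 := Subtype.ext hk'
    simp [N, this]
  refine ⟨{ toFun f := ∑ᶠ k, N k f
            map_add' f g := ?_
            map_smul' a f := ?_ }, fun k f hf => ?_⟩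
  · simp only [map_add]
    exact finsum_add_distrib (hfin f) (hfin g)
  · simp only [map_smul, RingHom.id_apply]
    exact (smul_finsum' a (hfin f)).symm
  · refine (finsum_eq_single (fun k => N k f) k fun j hj => ?_).trans ?_
    · have : P j f = 0 := Subtype.ext (Q.proj_of_ne (Ne.symm hj) hf)
      simp [N, this]
    · have : P k f = f := Subtype.ext (Q.proj_same hf)
      simp [N, this]

-- Partial lifts and their extension to new generators.

section Lifts

variable {A : StrictlyUnitalAInfCat.{u, v} R} {B : AInfCat.{u, v'} R}
  {C : StrictlyUnitalAInfCat.{u, v''} R} (G : StrictFunctor C.toAInfCat B) {o : A.Obj → C.Obj}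
  (F : FunctorOver A.toAInfCat B fun x => G.obj (o x))

/-- On the subquiver `S`, the map `φ` is a morphism of DG quivers lifting `F` along `G`; outside of
`S` its values are irrelevant. -/
structure IsDGLift (S : SubFamily A.toGradedQuiver)
    (φ : ∀ x y : A.Obj, A.Hom x y → C.Hom (o x) (o y)) : Prop where
  add : ∀ {x y} {f g : A.Hom x y}, f ∈ S x y → g ∈ S x y → φ x y (f + g) = φ x y f + φ x y g
  smul : ∀ {x y} (a : R) {f : A.Hom x y}, f ∈ S x y → φ x y (a • f) = a • φ x y f
  mem_gr : ∀ {x y} {k : ℤ} {f : A.Hom x y}, f ∈ S x y → f ∈ A.gr x y k →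
    φ x y f ∈ C.gr (o x) (o y) k
  map_d : ∀ {x y} {f : A.Hom x y}, f ∈ S x y → φ x y (A.d f) = C.d (φ x y f)
  map_eq : ∀ {x y} {f : A.Hom x y}, f ∈ S x y → G.map (φ x y f) = F.map f

/-- On the subcategory `S`, the map `φ` is a strictly unital strict A∞-functor lifting `F` along
`G`. -/
structure IsFunctorLift (S : SubFamily A.toGradedQuiver)
    (φ : ∀ x y : A.Obj, A.Hom x y → C.Hom (o x) (o y)) : Prop extends IsDGLift G F S φ where
  map_m_of_two_le : ∀ {x y} (c : Chain A.Hom x y), c.All (fun x y f => f ∈ S x y) →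
    2 ≤ c.length → φ x y (A.m c) = C.m (c.map o (φ _ _))
  map_one : ∀ x, φ x x (A.one x) = C.one (o x)

variable {G F} {S S' : SubFamily A.toGradedQuiver}
  {φ φ' : ∀ x y : A.Obj, A.Hom x y → C.Hom (o x) (o y)}

theorem IsDGLift.zero (h : IsDGLift G F S φ) (x y : A.Obj) : φ x y 0 = 0 := by
  simpa using h.smul (x := x) (y := y) 0 (zero_mem _)

theorem IsFunctorLift.map_m (h : IsFunctorLift G F S φ) {x y : A.Obj} (c : Chain A.Hom x y)
    (hc : c.All fun x y f => f ∈ S x y) : φ x y (A.m c) = C.m (c.map o (φ _ _)) := by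
  match c, hc with
  | .nil, _ => rw [A.m_nil, h.zero]; exact (C.m_nil _).symm
  | .cons f .nil, hc => exact h.map_d hc.1
  | .cons f (.cons g c), hc => exact h.map_m_of_two_le _ hc (by simp [Chain.length])

theorem IsDGLift.congr (h : IsDGLift G F S φ) (hS : ∀ {x y} {f : A.Hom x y}, f ∈ S x y →
    A.d f ∈ S x y) (hφ : ∀ {x y} {f : A.Hom x y}, f ∈ S x y → φ' x y f = φ x y f) :
    IsDGLift G F S φ' where
  add hf hg := by rw [hφ hf, hφ hg, hφ (add_mem hf hg), h.add hf hg]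
  smul a f hf := by rw [hφ hf, hφ (Submodule.smul_mem _ _ hf), h.smul a hf]
  mem_gr hf hk := by rw [hφ hf]; exact h.mem_gr hf hk
  map_d hf := by rw [hφ hf, hφ (hS hf), h.map_d hf]
  map_eq hf := by rw [hφ hf, h.map_eq hf]

theorem IsFunctorLift.congr (h : IsFunctorLift G F S φ) (hS : A.IsSubcategory S)
    (h1 : ∀ x, A.one x ∈ S x x)
    (hφ : ∀ {x y} {f : A.Hom x y}, f ∈ S x y → φ' x y f = φ x y f) :
    IsFunctorLift G F S φ' where
  toIsDGLift := h.toIsDGLift.congr (fun hf => hS.m_mem ⟨hf, trivial⟩) hφ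
  map_m_of_two_le c hc hl := by
    rw [hφ (hS.m_mem hc), h.map_m_of_two_le c hc hl]
    exact congrArg _ (Chain.map_congr (hc.mono fun x y f hf => (hφ hf).symm))
  map_one x := by rw [hφ (h1 x), h.map_one]

/-- Lifting from a subcategory to a relatively free graded quiver: on the new generators. -/
theorem exists_lift_generators (hG : G.IsQuasiFullyFaithful) (hGs : G.SurjectiveOnMorphisms)
    {W : SubFamily A.toGradedQuiver} (hW : IsGradedSub W) [∀ x y, Module.Free R (W x y)]
    (hd : ∀ x y (f : A.Hom x y), f ∈ W x y → A.d f ∈ S x y)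
    (h : IsDGLift G F S φ) (x y : A.Obj) :
    ∃ β : A.Hom x y → C.Hom (o x) (o y),
      (∀ f ∈ W x y, ∀ g ∈ W x y, β (f + g) = β f + β g) ∧
      (∀ a : R, ∀ f ∈ W x y, β (a • f) = a • β f) ∧
      (∀ k, ∀ f ∈ W x y, f ∈ A.gr x y k → β f ∈ C.gr (o x) (o y) k) ∧
      (∀ f ∈ W x y, C.d (β f) = φ x y (A.d f)) ∧
      (∀ f ∈ W x y, G.map (β f) = F.map f) := by
  classical
  -- Both requirements on the image `c` of `f` are combined into the single linear equation `T c = ψ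
  -- f`.
  let T : C.Hom (o x) (o y) →ₗ[R] C.Hom (o x) (o y) × B.Hom (G.obj (o x)) (G.obj (o y)) :=
    (C.dLin _ _).prod G.map
  let ψ : W x y →ₗ[R] C.Hom (o x) (o y) × B.Hom (G.obj (o x)) (G.obj (o y)) :=
    { toFun f := (φ x y (A.d f), F.map f)
      map_add' f g := by
        simp [A.d_add, h.add (hd _ _ _ f.2) (hd _ _ _ g.2)]
      map_smul' a f := by
        have : A.d (a • (f : A.Hom x y)) = a • A.d f := map_smul (A.dLin x y) a f.1
        simp [this, h.smul a (hd _ _ _ f.2)] }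
  have hψ : ∀ f, ψ f ∈ LinearMap.range T := fun f => by
    obtain ⟨c, hc, hc'⟩ := G.exists_d_eq_and_map_eq hG hGs (φ x y (A.d f))
      (by rw [← h.map_d (hd _ _ _ f.2), AInfCat.d_d, h.zero]) (F.map (f : A.Hom x y))
      (by rw [h.map_eq (hd _ _ _ f.2), F.map_d])
    exact ⟨c, Prod.ext hc hc'⟩
  -- Free modules are projective, so the pointwise solutions can be chosen linearly in `f`.
  obtain ⟨L, hL⟩ := Module.projective_lifting_property T.rangeRestrict
    (ψ.codRestrict _ hψ) T.surjective_rangeRestrict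
  have hL' : ∀ f, T (L f) = ψ f := fun f => congrArg Subtype.val (LinearMap.congr_fun hL f)
  have hLd : ∀ f, C.d (L f) = φ x y (A.d f) := fun f => congrArg Prod.fst (hL' f)
  have hLG : ∀ f, G.map (L f) = F.map (f : A.Hom x y) := fun f => congrArg Prod.snd (hL' f)
  -- The map `L` need not preserve degrees, since the basis of `W` is not assumed homogeneous. Its
  -- degree zero part still solves both equations: `d` and `G` commute with projections up to the
  -- degree shift, and the right-hand sides are homogeneous when `f` is.
  obtain ⟨β', hβ'⟩ := hW.exists_homogenization L
  refine ⟨fun f => if hf : f ∈ W x y then β' ⟨f, hf⟩ else 0, fun f hf g hg => ?_,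
    fun a f hf => ?_, fun k f hf hk => ?_, fun f hf => ?_, fun f hf => ?_⟩
  · simp only [dif_pos hf, dif_pos hg, dif_pos (add_mem hf hg)]
    exact map_add β' ⟨f, hf⟩ ⟨g, hg⟩
  · simp only [dif_pos hf, dif_pos ((W x y).smul_mem a hf)]
    exact map_smul β' a ⟨f, hf⟩
  · beta_reduce
    rw [dif_pos hf, hβ' k ⟨f, hf⟩ hk]
    exact C.proj_mem _ _
  · beta_reduce
    rw [dif_pos hf]
    refine hW.induction (p := fun f => ∀ hf : f ∈ W x y, C.d (β' ⟨f, hf⟩) = φ x y (A.d f))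
      (fun k f _ hk hf => ?_) (fun h0 => ?_) (fun f hf g hg hf' hg' hfg => ?_) hf hf
    · rw [hβ' k _ hk, ← C.dLin_apply, C.proj_comm 1 (C.dLin _ _) (fun _ _ => AInfCat.d_mem_gr),
        C.dLin_apply, hLd]
      exact C.proj_same (h.mem_gr (hd _ _ _ hf) (AInfCat.d_mem_gr hk))
    · rw [show (⟨0, h0⟩ : W x y) = 0 from rfl, map_zero, ← C.dLin_apply, ← A.dLin_apply,
        map_zero, map_zero, h.zero]
    · rw [show (⟨f + g, hfg⟩ : W x y) = ⟨f, hf⟩ + ⟨g, hg⟩ from rfl, map_add, C.d_add, hf' hf,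
        hg' hg, A.d_add, h.add (hd _ _ _ hf) (hd _ _ _ hg)]
  · beta_reduce
    rw [dif_pos hf]
    refine hW.induction (p := fun f => ∀ hf : f ∈ W x y, G.map (β' ⟨f, hf⟩) = F.map f)
      (fun k f _ hk hf => ?_) (fun h0 => ?_) (fun f hf g hg hf' hg' hfg => ?_) hf hf
    · have := C.proj_comm (Q' := B.toGradedQuiver) 0 (G.map (x := o x) (y := o y))
        (fun k f hf => by rw [add_zero]; exact G.map_mem_gr k f hf) k (L ⟨f, hf⟩)
      rw [hβ' k _ hk, this, hLG, add_zero]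
      exact B.proj_same (F.map_mem_gr k f hk)
    · rw [show (⟨0, h0⟩ : W x y) = 0 from rfl, map_zero, map_zero, map_zero]
    · rw [show (⟨f + g, hfg⟩ : W x y) = ⟨f, hf⟩ + ⟨g, hg⟩ from rfl, map_add, map_add, hf' hf,
        hg' hg, map_add]

/-- Lifting from a subcategory to a relatively free graded quiver. -/
theorem exists_isDGLift_sup (hG : G.IsQuasiFullyFaithful) (hGs : G.SurjectiveOnMorphisms)
    {W : SubFamily A.toGradedQuiver} (hW : IsGradedSub W) [∀ x y, Module.Free R (W x y)]
    (hS : A.IsSubcategory S) (hSW : ∀ x y, Disjoint (S x y) (W x y))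
    (hd : ∀ x y (f : A.Hom x y), f ∈ W x y → A.d f ∈ S x y) (h : IsDGLift G F S φ) :
    ∃ ψ : ∀ x y : A.Obj, A.Hom x y → C.Hom (o x) (o y),
      IsDGLift G F (fun x y => S x y ⊔ W x y) ψ ∧
      ∀ {x y} {f : A.Hom x y}, f ∈ S x y → ψ x y f = φ x y f := by
  classical
  choose β hadd hsmul hgr hβd hβG using exists_lift_generators hG hGs hW hd h
  have hβ0 : ∀ x y, β x y 0 = 0 := fun x y => by
    simpa using hsmul x y 0 0 (zero_mem _)
  -- A decomposition is picked for each element; disjointness of `S` and `W` makes the value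
  -- independent of it, and `0` is a dummy value outside the sum.
  let ψ : ∀ x y : A.Obj, A.Hom x y → C.Hom (o x) (o y) := fun x y f =>
    if hf : ∃ p : A.Hom x y × A.Hom x y, p.1 ∈ S x y ∧ p.2 ∈ W x y ∧ p.1 + p.2 = f
    then φ x y hf.choose.1 + β x y hf.choose.2 else 0
  have hψ : ∀ {x y} {s w : A.Hom x y}, s ∈ S x y → w ∈ W x y →
      ψ x y (s + w) = φ x y s + β x y w := fun {x y s w} hs hw => by
    have hf : ∃ p : A.Hom x y × A.Hom x y, p.1 ∈ S x y ∧ p.2 ∈ W x y ∧ p.1 + p.2 = s + w :=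
      ⟨(s, w), hs, hw, rfl⟩
    obtain ⟨h1, h2, h3⟩ := hf.choose_spec
    have h4 : hf.choose.1 - s = w - hf.choose.2 := by
      rw [sub_eq_sub_iff_add_eq_add, h3, add_comm]
    have h5 := (Submodule.disjoint_def.1 (hSW x y)) _ (sub_mem h1 hs)
      (h4 ▸ sub_mem hw h2)
    have h6 : ψ x y (s + w) = φ x y hf.choose.1 + β x y hf.choose.2 := dif_pos hf
    rw [h6, sub_eq_zero.1 h5]
    exact congrArg _ (congrArg _ (sub_eq_zero.1 (h4.symm.trans h5)).symm)
  have hψS : ∀ {x y} {f : A.Hom x y}, f ∈ S x y → ψ x y f = φ x y f := fun {x y f} hf => by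
    have := hψ hf (zero_mem (W x y))
    rwa [add_zero, hβ0, add_zero] at this
  refine ⟨ψ, ⟨?_, ?_, ?_, ?_, ?_⟩, hψS⟩
  · intro x y f g hf hg
    obtain ⟨s, hs, w, hw, rfl⟩ := Submodule.mem_sup.1 hf
    obtain ⟨s', hs', w', hw', rfl⟩ := Submodule.mem_sup.1 hg
    rw [add_add_add_comm, hψ (add_mem hs hs') (add_mem hw hw'), hψ hs hw, hψ hs' hw',
      h.add hs hs', hadd x y _ hw _ hw', add_add_add_comm]
  · intro x y a f hf
    obtain ⟨s, hs, w, hw, rfl⟩ := Submodule.mem_sup.1 hf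
    rw [smul_add, hψ (Submodule.smul_mem _ a hs) (Submodule.smul_mem _ a hw), hψ hs hw,
      h.smul a hs, hsmul x y a _ hw, smul_add]
  · intro x y k f hf hk
    obtain ⟨s, hs, w, hw, rfl⟩ := Submodule.mem_sup.1 hf
    -- The chosen summands of a homogeneous element need not be homogeneous, so they are replaced by
    -- their components of degree `k`.
    rw [← A.proj_same hk, map_add, hψ (hS.1.proj_mem hs k) (hW.proj_mem hw k)]
    exact add_mem (h.mem_gr (hS.1.proj_mem hs k) (A.proj_mem k s))
      (hgr x y k _ (hW.proj_mem hw k) (A.proj_mem k w))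
  · intro x y f hf
    obtain ⟨s, hs, w, hw, rfl⟩ := Submodule.mem_sup.1 hf
    have hds : A.d s ∈ S x y := hS.m_mem ⟨hs, trivial⟩
    rw [A.d_add, hψS (add_mem hds (hd _ _ _ hw)), h.add hds (hd _ _ _ hw), hψ hs hw, C.d_add,
      h.map_d hs, hβd x y _ hw]
  · intro x y f hf
    obtain ⟨s, hs, w, hw, rfl⟩ := Submodule.mem_sup.1 hf
    rw [hψ hs hw, map_add, map_add, h.map_eq hs, hβG x y _ hw]

end Lifts

-- Evaluation of trees and their degrees.

section TreeEvaluation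

variable {α : Type v} {L : α → α → Type w}

mutual
/-- The value of a tree whose leaves are interpreted by `h` and whose nodes are interpreted as the
operations of `C`. -/
def Tree.evalWith (C : AInfCat.{u, v'} R) (o : α → C.Obj)
    (h : ∀ x y, L x y → C.Hom (o x) (o y)) {x y : α} : Tree L x y → C.Hom (o x) (o y)
  | .leaf f => h _ _ f
  | .node t t' c => C.m (.cons (Tree.evalWith C o h t) (.cons (Tree.evalWith C o h t')
      (Tree.evalWithChain C o h c)))
/-- Evaluation of all trees of a sequence. -/
def Tree.evalWithChain (C : AInfCat.{u, v'} R) (o : α → C.Obj)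
    (h : ∀ x y, L x y → C.Hom (o x) (o y)) {x y : α} :
    Chain (Tree L) x y → Chain C.Hom (o x) (o y)
  | .nil => .nil
  | .cons t c => .cons (Tree.evalWith C o h t) (Tree.evalWithChain C o h c)
end

theorem Tree.evalWithChain_eq (C : AInfCat.{u, v'} R) (o : α → C.Obj)
    (h : ∀ x y, L x y → C.Hom (o x) (o y)) {x y : α} (c : Chain (Tree L) x y) :
    Tree.evalWithChain C o h c = c.map o (Tree.evalWith C o h) := by
  induction c with
  | nil => rfl
  | cons t c ih => rw [Tree.evalWithChain, ih, Chain.map]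

theorem Tree.evalWith_graft (C : AInfCat.{u, v'} R) (o : α → C.Obj)
    (h : ∀ x y, L x y → C.Hom (o x) (o y)) {x y : α} (c : Chain (Tree L) x y)
    (hc : 2 ≤ c.length) :
    Tree.evalWith C o h (Tree.graft c hc) = C.m (c.map o (Tree.evalWith C o h)) := by
  match c, hc with
  | .cons t (.cons t' c), _ =>
    rw [Tree.graft, Tree.evalWith, Tree.evalWithChain_eq, Chain.map, Chain.map]
  | .cons _ .nil, h => simp [Chain.length] at h
  | .nil, h => simp [Chain.length] at h

variable {A : AInfCat.{u, v} R} {Q : SubFamily A.toGradedQuiver}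

theorem Tree.evalChain_eq {x y : A.Obj} (c : Chain (Tree (Homog Q)) x y) :
    Tree.evalChain c = c.map (K := A.Hom) (fun a => a) Tree.eval := by
  induction c with
  | nil => rfl
  | cons t c ih => rw [Tree.evalChain, ih, Chain.map]

theorem Tree.eval_graft {x y : A.Obj} (c : Chain (Tree (Homog Q)) x y) (hc : 2 ≤ c.length) :
    (Tree.graft c hc).eval = A.m (c.map (K := A.Hom) (fun a => a) Tree.eval) := by
  match c, hc with
  | .cons t (.cons t' c), _ =>
    rw [Tree.graft, Tree.eval, Tree.evalChain_eq, Chain.map, Chain.map]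
  | .cons _ .nil, h => simp [Chain.length] at h
  | .nil, h => simp [Chain.length] at h

theorem Tree.redDegChain_eq {x y : A.Obj} (c : Chain (Tree (Homog Q)) x y) :
    Tree.redDegChain c = c.degSum fun _ _ t => t.deg := by
  induction c with
  | nil => rfl
  | cons t c ih => rw [Tree.redDegChain, ih, Chain.degSum]

theorem Tree.deg_graft {x y : A.Obj} (c : Chain (Tree (Homog Q)) x y) (hc : 2 ≤ c.length) :
    (Tree.graft c hc).deg = (c.degSum fun _ _ t => t.deg) + 2 := by
  match c, hc with
  | .cons t (.cons t' c), _ =>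
    rw [Tree.graft, Tree.deg, Tree.redDegChain_eq, Chain.degSum, Chain.degSum]; ring
  | .cons _ .nil, h => simp [Chain.length] at h
  | .nil, h => simp [Chain.length] at h

theorem Tree.eval_mem_gr {x y : A.Obj} (t : Tree (Homog Q) x y) : t.eval ∈ A.gr x y t.deg := by
  refine Tree.graftInduction (motive := fun x y t => t.eval ∈ A.gr x y t.deg)
    (fun x y f => ?_) (fun x y c hc ih => ?_) t
  · rw [Tree.eval, Tree.deg]; exact f.mem_gr
  · rw [Tree.eval_graft, Tree.deg_graft]
    exact A.m_map_mem_gr (fun a => a) Tree.eval _ ih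

theorem Tree.evalWith_mem_gr {C : AInfCat.{u, v'} R} {o : A.Obj → C.Obj}
    {h : ∀ x y, Homog Q x y → C.Hom (o x) (o y)}
    (hh : ∀ x y f, h x y f ∈ C.gr (o x) (o y) f.deg) {x y : A.Obj} (t : Tree (Homog Q) x y) :
    Tree.evalWith C o h t ∈ C.gr (o x) (o y) t.deg := by
  refine Tree.graftInduction (motive := fun x y t => Tree.evalWith C o h t ∈ C.gr _ _ t.deg)
    (fun x y f => ?_) (fun x y c hc ih => ?_) t
  · rw [Tree.evalWith, Tree.deg]; exact hh _ _ f
  · rw [Tree.evalWith_graft, Tree.deg_graft]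
    exact C.m_map_mem_gr o (Tree.evalWith C o h) _ ih

end TreeEvaluation

-- The relations of the generated category hold in `C`.

section Lifts

variable {A : StrictlyUnitalAInfCat.{u, v} R} {B : AInfCat.{u, v'} R}
  {C : StrictlyUnitalAInfCat.{u, v''} R} {G : StrictFunctor C.toAInfCat B} {o : A.Obj → C.Obj}
  {F : FunctorOver A.toAInfCat B fun x => G.obj (o x)}
  {S Q T : SubFamily A.toGradedQuiver}
  {φ ψ : ∀ x y : A.Obj, A.Hom x y → C.Hom (o x) (o y)}

/-- The value in `C` of a tree labelled by morphisms of `A`. -/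
def Tree.lift (Q : SubFamily A.toGradedQuiver)
    (ψ : ∀ x y : A.Obj, A.Hom x y → C.Hom (o x) (o y)) {x y : A.Obj}
    (t : Tree (Homog Q) x y) : C.Hom (o x) (o y) :=
  Tree.evalWith C.toAInfCat o (fun x y f => ψ x y f.val) t

/-- The linear extension of `Tree.lift`. -/
def liftLin (Q : SubFamily A.toGradedQuiver)
    (ψ : ∀ x y : A.Obj, A.Hom x y → C.Hom (o x) (o y)) (x y : A.Obj) :
    (Tree (Homog Q) x y →₀ R) →ₗ[R] C.Hom (o x) (o y) :=
  Finsupp.linearCombination R (Tree.lift Q ψ)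

theorem liftLin_single {x y : A.Obj} (t : Tree (Homog Q) x y) (a : R) :
    liftLin Q ψ x y (Finsupp.single t a) = a • t.lift Q ψ :=
  Finsupp.linearCombination_single _ _ _

theorem Tree.lift_leaf {x y : A.Obj} (f : Homog Q x y) :
    (Tree.leaf f).lift Q ψ = ψ x y f.val := by
  rw [Tree.lift, Tree.evalWith]

theorem Tree.lift_graft {x y : A.Obj} (c : Chain (Tree (Homog Q)) x y) (hc : 2 ≤ c.length) :
    (Tree.graft c hc).lift Q ψ = C.m (c.map o (Tree.lift Q ψ)) :=
  Tree.evalWith_graft _ _ _ c hc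

theorem Tree.lift_mem_gr (h : IsDGLift G F Q ψ) {x y : A.Obj} (t : Tree (Homog Q) x y) :
    t.lift Q ψ ∈ C.gr (o x) (o y) t.deg :=
  Tree.evalWith_mem_gr (fun _ _ f => h.mem_gr f.mem f.mem_gr) t

/-- A DG quiver morphism that is an A∞-functor on `S` respects the relations of the strictly unital
A∞-category generated relative to `S`. -/
theorem FreeRel.liftLin_eq_zero (hQ : IsDGLift G F Q ψ) (hS : IsFunctorLift G F S ψ)
    {x y : A.Obj} {a : Tree (Homog Q) x y →₀ R} (ha : FreeRel A S Q a) :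
    liftLin Q ψ x y a = 0 := by
  induction ha with
  | add f g h hf hg hv =>
    simp only [map_sub, liftLin_single, one_smul, Tree.lift_leaf, hv, hQ.add f.mem g.mem]
    abel
  | smul a f h hf hv =>
    simp only [map_sub, liftLin_single, one_smul, Tree.lift_leaf, hv, hQ.smul a f.mem, sub_self]
  | rel c hc c' hcc' hdeg h hd hv =>
    simp only [map_sub, liftLin_single, one_smul, Tree.lift_leaf, hv, Tree.lift_graft]
    -- The labels of `c` and `c'` have the same underlying morphisms, so functoriality on `S`
    -- applies to a sequence labelled in `Q`.
    rw [hcc', hS.map_m _ c'.all_vals, ← hcc', Chain.vals, Chain.map_map, Chain.map_map,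
      sub_eq_zero]
    exact congrArg _ (Chain.map_congr
      (Chain.all_of_forall (fun _ _ f => (Tree.lift_leaf f).symm) c))
  | one_right t e hd he =>
    have h1 : Tree.lift Q ψ (.node (.leaf e) t .nil) = C.m₂ (t.lift Q ψ) (ψ _ _ e.val) := by
      rw [← Tree.lift_leaf (Q := Q) (ψ := ψ) e]
      exact Tree.lift_graft (.cons (.leaf e) (.cons t .nil)) (by simp [Chain.length])
    rw [map_sub, liftLin_single, liftLin_single, h1, he, hS.map_one, C.m₂_one, sub_self]
  | one_left t e hd he =>
    have h1 : Tree.lift Q ψ (.node t (.leaf e) .nil) = C.m₂ (ψ _ _ e.val) (t.lift Q ψ) := by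
      rw [← Tree.lift_leaf (Q := Q) (ψ := ψ) e]
      exact Tree.lift_graft (.cons t (.cons (.leaf e) .nil)) (by simp [Chain.length])
    rw [map_sub, liftLin_single, h1, he, hS.map_one, C.one_m₂ t.deg _ (t.lift_mem_gr hQ)]
    rcases Int.units_eq_one_or t.deg.negOnePow with h | h <;> simp [h, liftLin_single]
  | one_higher l e r h hd he =>
    rw [liftLin_single, Tree.lift_graft, Chain.map_append, Chain.map, Tree.lift_leaf, he,
      hS.map_one, C.m_one _ _ (by simpa only [Chain.length_map] using h), smul_zero]
  | zero_mem => exact map_zero _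
  | add_mem a b _ _ iha ihb => rw [map_add, iha, ihb, add_zero]
  | smul_mem r a _ ih => rw [map_smul, ih, smul_zero]
  | @graft_mem x y z s l a r h _ ih =>
    -- Grafting into a fixed slot becomes a linear map in `C`, so the combinations that are killed
    -- are stable under grafting.
    have h1 : ∀ t, Tree.lift Q ψ (Tree.graft (l.append (.cons t r))
        (by rw [Chain.length_append]; simp only [Chain.length]; omega)) =
        C.slot (l.map o (Tree.lift Q ψ)) (r.map o (Tree.lift Q ψ)) (Tree.lift Q ψ t) := fun t => by
      rw [Tree.lift_graft, Chain.map_append, Chain.map, AInfCat.slot_apply]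
    rw [liftLin, Finsupp.linearCombination_mapDomain]
    have h2 := congrArg (C.slot (l.map o (Tree.lift Q ψ)) (r.map o (Tree.lift Q ψ))) ih
    rw [liftLin, Finsupp.apply_linearCombination, map_zero] at h2
    rw [← h2]
    congr 2
    exact funext h1

end Lifts

-- Compatibility with the differential from the A∞-relations.

section Differential

variable {A : AInfCat.{u, v} R} {C : AInfCat.{u, v'} R} {o : A.Obj → C.Obj}
  {T : SubFamily A.toGradedQuiver}

/-- As `χ` is additive only on `T`, membership of the partial sums has to be carried through the
induction. -/
theorem map_sum_of_additive {x y : A.Obj} {x' y' : C.Obj} {χ : A.Hom x y → C.Hom x' y'}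
    (h0 : χ 0 = 0) (hadd : ∀ f ∈ T x y, ∀ g ∈ T x y, χ (f + g) = χ f + χ g) {ι : Type*}
    (l : List ι) {f : ι → A.Hom x y} (hf : ∀ i ∈ l, f i ∈ T x y) :
    χ (l.map f).sum = (l.map fun i => χ (f i)).sum ∧ (l.map f).sum ∈ T x y := by
  induction l with
  | nil => simp [h0]
  | cons i l ih =>
    obtain ⟨h1, h2⟩ := ih fun j hj => hf j (List.mem_cons_of_mem _ hj)
    have h3 := hf i List.mem_cons_self
    simp only [List.map_cons, List.sum_cons]
    exact ⟨by rw [hadd _ h3 _ h2, h1], add_mem h3 h2⟩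

variable {χ : ∀ x y : A.Obj, A.Hom x y → C.Hom (o x) (o y)} {L : A.Obj → A.Obj → Type w}
  {hA : ∀ {x y}, L x y → A.Hom x y}

/-- Sequences of length one need a separate hypothesis: compatibility with `m¹` is what is being
proved, and is available only for the given entries. -/
theorem map_m_map (h0 : ∀ x y, χ x y 0 = 0)
    (hm : ∀ {x y} (c : Chain A.Hom x y), c.All (fun x y f => f ∈ T x y) → 2 ≤ c.length →
      χ x y (A.m c) = C.m (c.map o (χ _ _)))
    (hAT : ∀ x y (f : L x y), hA f ∈ T x y) {x y : A.Obj} (c : Chain L x y)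
    (hd : c.All fun x y f => χ x y (A.d (hA f)) = C.d (χ x y (hA f))) :
    χ x y (A.m (c.map (fun a => a) hA)) = C.m (c.map o fun f => χ _ _ (hA f)) := by
  match c, hd with
  | .nil, _ => simp only [Chain.map, A.m_nil, C.m_nil, h0]
  | .cons f .nil, hd => exact hd.1
  | .cons f (.cons g c), _ =>
    rw [hm _ ((Chain.all_map _ _).2 (Chain.all_of_forall hAT _))
      (by simp [Chain.length_map, Chain.length]), Chain.map_map]

/-- By the A∞-relations, a map that commutes with the higher operations and with the differentials
of the entries of a sequence `p` commutes with the differential of `m p`. -/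
theorem map_d_m (hT : A.IsSubcategory T) (hadd : ∀ x y, ∀ f ∈ T x y, ∀ g ∈ T x y,
      χ x y (f + g) = χ x y f + χ x y g)
    (hsmul : ∀ x y (a : R), ∀ f ∈ T x y, χ x y (a • f) = a • χ x y f)
    (hm : ∀ {x y} (c : Chain A.Hom x y), c.All (fun x y f => f ∈ T x y) → 2 ≤ c.length →
      χ x y (A.m c) = C.m (c.map o (χ _ _)))
    (dg : ∀ x y, L x y → ℤ) (hAT : ∀ x y (f : L x y), hA f ∈ T x y)
    (hAg : ∀ x y (f : L x y), hA f ∈ A.gr x y (dg x y f))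
    (hCg : ∀ x y (f : L x y), χ x y (hA f) ∈ C.gr (o x) (o y) (dg x y f))
    {x y : A.Obj} (p : Chain L x y) (hp : 2 ≤ p.length)
    (hd : p.All fun x y f => χ x y (A.d (hA f)) = C.d (χ x y (hA f))) :
    χ x y (A.d (A.m (p.map (fun a => a) hA))) = C.d (χ x y (A.m (p.map (fun a => a) hA))) := by
  have h0 : ∀ x y, χ x y 0 = 0 := fun x y => by simpa using hsmul x y 0 0 (zero_mem _)
  have hunits : ∀ (u : ℤˣ) {x y} {f : A.Hom x y}, f ∈ T x y →
      u • f ∈ T x y ∧ χ x y (u • f) = u • χ x y f := fun u {x y f} hf => by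
    rcases Int.units_eq_one_or u with rfl | rfl
    · simpa using hf
    · have := hsmul x y (-1) f hf
      simp only [neg_smul, one_smul] at this
      simpa [Units.neg_smul] using ⟨hf, this⟩
  have hmapT : ∀ {x y} (c : Chain L x y),
      (c.map (K := A.Hom) (fun a => a) hA).All fun x y f => f ∈ T x y := fun c =>
    (Chain.all_map _ _).2 (Chain.all_of_forall hAT c)
  let tA : (s : Σ z, Chain L x z × Chain L z y) → (Σ z, Chain L x z × Chain L z s.1) →
      A.Hom x y := fun s s' =>
    A.m ((s'.2.1.map (fun a => a) hA).append
      (.cons (A.m (s'.2.2.map (fun a => a) hA)) (s.2.2.map (fun a => a) hA)))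
  let tC : (s : Σ z, Chain L x z × Chain L z y) → (Σ z, Chain L x z × Chain L z s.1) →
      C.Hom (o x) (o y) := fun s s' =>
    C.m ((s'.2.1.map o fun f => χ _ _ (hA f)).append
      (.cons (C.m (s'.2.2.map o fun f => χ _ _ (hA f))) (s.2.2.map o fun f => χ _ _ (hA f))))
  -- The signed failure of `χ` to carry a summand of the relation in `A` to the matching summand in
  -- `C`.
  let δ : (s : Σ z, Chain L x z × Chain L z y) → (Σ z, Chain L x z × Chain L z s.1) →
      C.Hom (o x) (o y) := fun s s' =>
    (s'.2.1.degSum dg).negOnePow • (χ x y (tA s s') - tC s s')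
  have hall : ∀ (s : Σ z, Chain L x z × Chain L z y) (s' : Σ z, Chain L x z × Chain L z s.1),
      ((s'.2.1.map (fun a => a) hA).append (.cons (A.m (s'.2.2.map (fun a => a) hA))
        (s.2.2.map (fun a => a) hA))).All fun x y f => f ∈ T x y := fun s s' =>
    Chain.all_append.2 ⟨hmapT _, hT.m_mem (hmapT _), hmapT _⟩
  have htA : ∀ s s', tA s s' ∈ T x y := fun s s' => hT.m_mem (hall s s')
  -- If something remains beside the inner sequence, the outer operation has at least two inputs and
  -- `hm` applies to it. The inner one is covered by `map_m_map`, where length one uses `hd`.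
  have hδ : ∀ s ∈ p.splits, ∀ s' ∈ s.2.1.splits,
      s'.2.1.length ≠ 0 ∨ s.2.2.length ≠ 0 → δ s s' = 0 := fun s hs s' hs' hl => by
    have hd' : s'.2.2.All fun x y f => χ x y (A.d (hA f)) = C.d (χ x y (hA f)) := by
      rw [← Chain.append_of_mem_splits hs, Chain.all_append,
        ← Chain.append_of_mem_splits hs', Chain.all_append] at hd
      exact hd.1.2
    have : χ x y (tA s s') = tC s s' := by
      simp only [tA, tC]
      rw [hm _ (hall s s') (by
          rw [Chain.length_append]; simp only [Chain.length, Chain.length_map]; omega),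
        Chain.map_append, Chain.map, Chain.map_map, Chain.map_map, map_m_map h0 hm hAT _ hd']
    simp only [δ, this, sub_self, smul_zero]
  have hsA := congrArg (χ x y) (A.stasheff_map (fun a => a) hA dg hAg p)
  have hsC := C.stasheff_map o (fun f => χ _ _ (hA f)) dg hCg p
  have hin : ∀ s : Σ z, Chain L x z × Chain L z y, χ x y (s.2.1.splits.map fun s' =>
      (s'.2.1.degSum dg).negOnePow • tA s s').sum = (s.2.1.splits.map fun s' =>
      (s'.2.1.degSum dg).negOnePow • tC s s').sum + (s.2.1.splits.map (δ s)).sum := fun s => by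
    rw [(map_sum_of_additive (T := T) (h0 x y) (hadd x y) _
      fun s' _ => (hunits _ (htA s s')).1).1, ← List.sum_map_add]
    congr 2
    funext s'
    rw [(hunits _ (htA s s')).2]
    simp only [δ, smul_sub]
    abel
  rw [h0, (map_sum_of_additive (T := T) (h0 x y) (hadd x y) _ fun s _ =>
    (map_sum_of_additive (T := T) (h0 x y) (hadd x y) _
      fun s' _ => (hunits _ (htA s s')).1).2).1] at hsA
  have hsum : (p.splits.map fun s => (s.2.1.splits.map (δ s)).sum).sum = 0 := by
    have := hsA
    rw [List.map_congr_left (fun s _ => hin s), List.sum_map_add] at this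
    rw [hsC, zero_add] at this
    exact this
  -- The failures sum to zero and all but one vanish, so the last one, which concerns `d (m p)`,
  -- vanishes too.
  rw [Chain.sum_splits_of_right _ _ fun s hs hl => List.sum_eq_zero fun a ha => by
      obtain ⟨s', hs', rfl⟩ := List.mem_map.1 ha
      exact hδ s hs s' hs' (.inr hl),
    Chain.sum_splits_of_left _ _ fun s' hs' hl =>
      hδ ⟨y, p, .nil⟩ p.right_mem_splits s' hs' (.inl hl)] at hsum
  have hfin : χ x y (A.d (A.m (p.map (fun a => a) hA))) -
      C.d (C.m (p.map o fun f => χ _ _ (hA f))) = 0 := by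
    simpa [δ, tA, tC, Chain.degSum, Chain.map, Chain.append, AInfCat.d, Chain.single] using hsum
  rw [sub_eq_zero.1 hfin, hm _ (hmapT p) (by rwa [Chain.length_map]), Chain.map_map]

end Differential

-- Extension from generators to the generated category.

section Lifts

variable {A : StrictlyUnitalAInfCat.{u, v} R} {B : AInfCat.{u, v'} R}
  {C : StrictlyUnitalAInfCat.{u, v''} R} {G : StrictFunctor C.toAInfCat B} {o : A.Obj → C.Obj}
  {F : FunctorOver A.toAInfCat B fun x => G.obj (o x)}
  {S Q T : SubFamily A.toGradedQuiver}
  {φ ψ : ∀ x y : A.Obj, A.Hom x y → C.Hom (o x) (o y)}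

theorem evalLin_single {x y : A.Obj} (t : Tree (Homog Q) x y) (a : R) :
    evalLin (A := A.toAInfCat) Q x y (Finsupp.single t a) = a • t.eval :=
  Finsupp.linearCombination_single _ _ _

/-- A morphism of DG quivers on `Q` which is an A∞-functor on `S` extends to the strictly unital
A∞-category generated by `Q` relative to `S`. -/
theorem exists_isFunctorLift_of_generated (hQ : IsDGLift G F Q ψ) (hS : IsFunctorLift G F S ψ)
    (hQg : IsGradedSub Q) (hQd : ∀ {x y} {f : A.Hom x y}, f ∈ Q x y → A.d f ∈ S x y)
    (hSQ : ∀ x y, S x y ≤ Q x y) (h1 : ∀ x, A.one x ∈ S x x) (hT : A.IsSubcategory T)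
    (hrange : ∀ x y, LinearMap.range (evalLin (A := A.toAInfCat) Q x y) = T x y)
    (hker : ∀ x y (a : Tree (Homog Q) x y →₀ R), evalLin (A := A.toAInfCat) Q x y a = 0 →
      FreeRel A S Q a) :
    ∃ χ : ∀ x y : A.Obj, A.Hom x y → C.Hom (o x) (o y), IsFunctorLift G F T χ ∧
      (∀ x y, Q x y ≤ T x y) ∧ ∀ {x y} {f : A.Hom x y}, f ∈ Q x y → χ x y f = ψ x y f := by
  classical
  let E : ∀ x y, (Tree (Homog Q) x y →₀ R) →ₗ[R] A.Hom x y := evalLin (A := A.toAInfCat) Q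
  -- The value at `f` is computed from a chosen combination of trees representing `f`. Two choices
  -- differ by an element of the kernel, which `liftLin` kills.
  let χ : ∀ x y : A.Obj, A.Hom x y → C.Hom (o x) (o y) := fun x y f =>
    if hf : ∃ a, E x y a = f then liftLin Q ψ x y hf.choose else 0
  have hχ : ∀ {x y} (a : Tree (Homog Q) x y →₀ R), χ x y (E x y a) = liftLin Q ψ x y a :=
    fun {x y} a => by
      have hf : ∃ b, E x y b = E x y a := ⟨a, rfl⟩
      have h : χ x y (E x y a) = liftLin Q ψ x y hf.choose := dif_pos hf
      rw [h, ← sub_eq_zero, ← map_sub]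
      refine FreeRel.liftLin_eq_zero hQ hS (hker _ _ _ ?_)
      rw [map_sub, sub_eq_zero]
      exact hf.choose_spec
  have hE : ∀ {x y} {f : A.Hom x y}, f ∈ T x y → ∃ a, E x y a = f := fun {x y f} hf => by
    rw [← hrange] at hf
    exact hf
  have hET : ∀ {x y} (a : Tree (Homog Q) x y →₀ R), E x y a ∈ T x y := fun {x y} a => by
    rw [← hrange]
    exact ⟨a, rfl⟩
  have hEt : ∀ {x y} (t : Tree (Homog Q) x y), E x y (Finsupp.single t 1) = t.eval :=
    fun t => (evalLin_single t 1).trans (one_smul _ _)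
  have htT : ∀ {x y} (t : Tree (Homog Q) x y), t.eval ∈ T x y := fun t => hEt t ▸ hET _
  have hχt : ∀ {x y} (t : Tree (Homog Q) x y), χ x y t.eval = t.lift Q ψ := fun t => by
    rw [← hEt, hχ, liftLin_single, one_smul]
  have hadd : ∀ x y, ∀ f ∈ T x y, ∀ g ∈ T x y, χ x y (f + g) = χ x y f + χ x y g := by
    intro x y f hf g hg
    obtain ⟨a, rfl⟩ := hE hf
    obtain ⟨b, rfl⟩ := hE hg
    rw [← map_add, hχ, hχ, hχ, map_add]
  have hsmul : ∀ x y (r : R), ∀ f ∈ T x y, χ x y (r • f) = r • χ x y f := by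
    intro x y r f hf
    obtain ⟨a, rfl⟩ := hE hf
    rw [← map_smul, hχ, hχ, map_smul]
  have h0 : ∀ x y, χ x y 0 = 0 := fun x y => by simpa using hsmul x y 0 0 (zero_mem _)
  have hind : ∀ {x y} {p : A.Hom x y → Prop}, (∀ t : Tree (Homog Q) x y, p t.eval) → p 0 →
      (∀ f ∈ T x y, ∀ g ∈ T x y, p f → p g → p (f + g)) →
      (∀ r : R, ∀ f ∈ T x y, p f → p (r • f)) → ∀ {f}, f ∈ T x y → p f := by
    intro x y p ht hz ha hs f hf
    obtain ⟨a, rfl⟩ := hE hf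
    induction a using Finsupp.induction_linear with
    | zero => rwa [map_zero]
    | add a b iha ihb => rw [map_add]; exact ha _ (hET a) _ (hET b) (iha (hET a)) (ihb (hET b))
    | single t r =>
      have : E x y (Finsupp.single t r) = r • t.eval := evalLin_single t r
      rw [this]
      exact hs _ _ (htT t) (ht t)
  -- A homogeneous element may be represented by trees of various degrees. Commutation with all
  -- projections can be tested on single trees and yields preservation of degree.
  have hgr : ∀ {x y} {f : A.Hom x y}, f ∈ T x y → ∀ k,
      χ x y (A.proj x y k f) = C.proj _ _ k (χ x y f) := by
    intro x y f hf k
    refine hind (p := fun f => χ x y (A.proj x y k f) = C.proj _ _ k (χ x y f)) (fun t => ?_)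
      (by rw [map_zero, h0, map_zero]) (fun f hf g hg h h' => ?_) (fun r f hf h => ?_) hf
    · by_cases hk : t.deg = k
      · rw [← hk, A.proj_same t.eval_mem_gr, hχt, C.proj_same (t.lift_mem_gr hQ)]
      · rw [A.proj_of_ne hk t.eval_mem_gr, hχt, C.proj_of_ne hk (t.lift_mem_gr hQ), h0]
    · rw [map_add, hadd _ _ _ (hT.1.proj_mem hf k) _ (hT.1.proj_mem hg k), h, h',
        hadd _ _ _ hf _ hg, map_add]
    · rw [map_smul, hsmul _ _ _ _ (hT.1.proj_mem hf k), h, hsmul _ _ _ _ hf, map_smul]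
  -- Entries are replaced by trees one at a time using multilinearity: `l` is the part already
  -- replaced and `c` the rest. When `c` is empty, the operation is a grafting.
  have hmtree : ∀ {x y z} (l : Chain (Tree (Homog Q)) x y) (c : Chain A.Hom y z),
      c.All (fun x y f => f ∈ T x y) → 2 ≤ l.length + c.length →
      χ x z (A.m ((l.map (fun a => a) Tree.eval).append c)) =
        C.m ((l.map o (Tree.lift Q ψ)).append (c.map o (χ _ _))) := by
    intro x y z l c hc hl
    induction c with
    | nil =>
      rw [Chain.append_nil, Chain.map, Chain.append_nil,
        ← Tree.eval_graft l (by simpa [Chain.length] using hl), hχt, Tree.lift_graft]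
    | @cons y z t f c ih =>
      have hl' : ∀ g : A.Hom y z, g ∈ T y z →
          A.slot (l.map (fun a => a) Tree.eval) c g ∈ T x t := fun g hg =>
        hT.m_mem (Chain.all_append.2 ⟨(Chain.all_map _ _).2 (Chain.all_of_forall
          (fun _ _ t => htT t) l), hg, hc.2⟩)
      refine hind (p := fun f => χ x t (A.slot (l.map (fun a => a) Tree.eval) c f) =
        C.slot (l.map o (Tree.lift Q ψ)) (c.map o (χ _ _)) (χ _ _ f)) (fun s => ?_)
        (by rw [map_zero, h0, h0, map_zero]) (fun f hf g hg h h' => ?_) (fun r f hf h => ?_) hc.1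
      · have := ih (l.append (.single s)) hc.2 (by
          rw [Chain.length_append]; simp only [Chain.length, Chain.single] at hl ⊢; omega)
        rw [Chain.map_append, Chain.map_append, Chain.append_assoc, Chain.append_assoc] at this
        rw [hχt]
        exact this
      · rw [map_add, hadd _ _ _ (hl' f hf) _ (hl' g hg), h, h', hadd _ _ _ hf _ hg, map_add]
      · rw [map_smul, hsmul _ _ _ _ (hl' f hf), h, hsmul _ _ _ _ hf, map_smul]
  have hm : ∀ {x y} (c : Chain A.Hom x y), c.All (fun x y f => f ∈ T x y) → 2 ≤ c.length →
      χ x y (A.m c) = C.m (c.map o (χ _ _)) := fun c hc hl =>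
    hmtree .nil c hc (by simpa [Chain.length] using hl)
  have hQT : ∀ x y, Q x y ≤ T x y := fun x y f hf =>
    hQg.induction (p := fun f => f ∈ T x y)
      (fun k f hf hk => by simpa only [Tree.eval] using htT (.leaf ⟨k, f, hf, hk⟩)) (zero_mem _)
      (fun f _ g _ h h' => add_mem h h') hf
  have hQψ : ∀ {x y} {f : A.Hom x y}, f ∈ Q x y → χ x y f = ψ x y f := fun {x y f} hf =>
    hQg.induction (p := fun f => χ x y f = ψ x y f)
      (fun k f hf hk => by
        simpa only [Tree.eval, Tree.lift_leaf] using hχt (.leaf ⟨k, f, hf, hk⟩))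
      (by rw [h0, hQ.zero])
      (fun f hf g hg h h' => by rw [hadd _ _ _ (hQT _ _ hf) _ (hQT _ _ hg), h, h', hQ.add hf hg]) hf
  -- At a leaf the differential lies in `S`, where `χ` agrees with `ψ`; at a node `map_d_m` reduces
  -- the claim to the subtrees.
  have hdtree : ∀ {x y} (t : Tree (Homog Q) x y), χ x y (A.d t.eval) = C.d (χ x y t.eval) := by
    intro x y t
    refine Tree.graftInduction (motive := fun x y t => χ x y (A.d t.eval) = C.d (χ x y t.eval))
      (fun x y f => ?_) (fun x y c hc ih => ?_) t
    · rw [Tree.eval, hQψ (hSQ _ _ (hQd f.mem)), hQψ f.mem, hQ.map_d f.mem]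
    · rw [Tree.eval_graft]
      exact map_d_m hT hadd hsmul hm (fun _ _ t => t.deg) (fun _ _ t => htT t)
        (fun _ _ t => t.eval_mem_gr) (fun _ _ t => by rw [hχt]; exact t.lift_mem_gr hQ) c hc ih
  have hdT : ∀ {x y} {f : A.Hom x y}, f ∈ T x y → A.dLin x y f ∈ T x y := fun hf =>
    hT.m_mem ⟨hf, trivial⟩
  refine ⟨χ, ⟨⟨fun hf hg => hadd _ _ _ hf _ hg, fun r f hf => hsmul _ _ r _ hf, ?_, ?_, ?_⟩,
    hm, fun x => ?_⟩, hQT, hQψ⟩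
  · intro x y k f hf hk
    rw [← A.proj_same hk, hgr hf]
    exact C.proj_mem _ _
  · intro x y f hf
    refine hind (p := fun f => χ x y (A.dLin x y f) = C.dLin _ _ (χ x y f)) hdtree
      (by rw [map_zero, h0, map_zero]) (fun f hf g hg h h' => ?_) (fun r f hf h => ?_) hf
    · rw [map_add, hadd _ _ _ (hdT hf) _ (hdT hg), h, h', hadd _ _ _ hf _ hg, map_add]
    · rw [map_smul, hsmul _ _ _ _ (hdT hf), h, hsmul _ _ _ _ hf, map_smul]
  · intro x y f hf
    refine hind (p := fun f => G.map (χ x y f) = F.map f) (fun t => ?_)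
      (by rw [h0, map_zero, map_zero]) (fun f hf g hg h h' => ?_) (fun r f hf h => ?_) hf
    · refine Tree.graftInduction (motive := fun x y t => G.map (χ x y t.eval) = F.map t.eval)
        (fun x y f => ?_) (fun x y c hc ih => ?_) t
      · rw [Tree.eval, hQψ f.mem, hQ.map_eq f.mem]
      · rw [hχt, Tree.lift_graft, Tree.eval_graft, G.map_m, F.map_m, Chain.map_map, Chain.map_map]
        exact congrArg _ (Chain.map_congr (ih.mono fun _ _ t ht => by rw [← hχt, ht]))
    · rw [hadd _ _ _ hf _ hg, map_add, map_add, h, h']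
    · rw [hsmul _ _ _ _ hf, map_smul, map_smul, h]
  · rw [hQψ (hSQ _ _ (h1 x)), hS.map_one]

/-! ### The discrete category -/

theorem one_mem_unitSpan (x : A.Obj) : A.one x ∈ unitSpan A x x :=
  Submodule.subset_span ⟨rfl, rfl⟩

theorem mem_unitSpan_self {x : A.Obj} {f : A.Hom x x} (hf : f ∈ unitSpan A x x) :
    ∃ r : R, f = r • A.one x := by
  have : {f | ∃ h : x = x, f = h ▸ A.one x} = {A.one x} := by
    ext f; simp
  rw [unitSpan, this] at hf
  obtain ⟨r, hr⟩ := Submodule.mem_span_singleton.1 hf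
  exact ⟨r, hr.symm⟩

theorem mem_unitSpan_of_ne {x y : A.Obj} (hxy : x ≠ y) {f : A.Hom x y}
    (hf : f ∈ unitSpan A x y) : f = 0 := by
  have : {f : A.Hom x y | ∃ h : x = y, f = h ▸ A.one x} = ∅ := by
    ext f; simp [hxy]
  rw [unitSpan, this] at hf
  simpa using hf

/-- The only unital lift on the discrete category. -/
theorem exists_isFunctorLift_unitSpan (hU : A.IsSubcategory (unitSpan A))
    (hfree : ∀ (x : A.Obj) (a : R), a • A.one x = 0 → a = 0)
    (hG1 : ∀ x, G.map (C.one (o x)) = F.map (A.one x)) :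
    ∃ φ : ∀ x y : A.Obj, A.Hom x y → C.Hom (o x) (o y), IsFunctorLift G F (unitSpan A) φ := by
  classical
  -- A multiple `r • 1` goes to `r • 1`; `hfree` makes the coefficient unique. Everything else gets
  -- the value zero.
  let φ : ∀ x y : A.Obj, A.Hom x y → C.Hom (o x) (o y) := fun x y f =>
    if hxy : x = y then
      if hf : ∃ r : R, f = r • (hxy ▸ A.one x : A.Hom x y) then
        hf.choose • (hxy ▸ C.one (o x) : C.Hom (o x) (o y))
      else 0
    else 0
  have hφ : ∀ x (r : R), φ x x (r • A.one x) = r • C.one (o x) := fun x r => by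
    have hf : ∃ s : R, r • A.one x = s • A.one x := ⟨r, rfl⟩
    have h : φ x x (r • A.one x) = hf.choose • C.one (o x) := (dif_pos rfl).trans (dif_pos hf)
    have h' : hf.choose - r = 0 := hfree x _ (by rw [sub_smul, ← hf.choose_spec, sub_self])
    rw [h, sub_eq_zero.1 h']
  have hφ1 : ∀ x, φ x x (A.one x) = C.one (o x) := fun x => by
    simpa using hφ x 1
  have hφne : ∀ {x y}, x ≠ y → ∀ f, φ x y f = 0 := fun hxy f => dif_neg hxy
  have hsmul : ∀ {x y} (r : R) {f : A.Hom x y}, f ∈ unitSpan A x y →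
      φ x y (r • f) = r • φ x y f := fun {x y} r {f} hf => by
    by_cases hxy : x = y
    · subst hxy
      obtain ⟨s, rfl⟩ := mem_unitSpan_self hf
      rw [smul_smul, hφ, hφ, smul_smul]
    · rw [hφne hxy, hφne hxy, smul_zero]
  have h0 : ∀ x y, φ x y 0 = 0 := fun x y => by
    simpa using hsmul (x := x) (y := y) 0 (zero_mem _)
  refine ⟨φ, ⟨⟨?_, hsmul, ?_, ?_, ?_⟩, ?_, hφ1⟩⟩
  · intro x y f g hf hg
    by_cases hxy : x = y
    · subst hxy
      obtain ⟨s, rfl⟩ := mem_unitSpan_self hf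
      obtain ⟨r, rfl⟩ := mem_unitSpan_self hg
      rw [← add_smul, hφ, hφ, hφ, add_smul]
    · rw [hφne hxy, hφne hxy, hφne hxy, add_zero]
  · intro x y k f hf hk
    by_cases hxy : x = y
    · subst hxy
      obtain ⟨s, rfl⟩ := mem_unitSpan_self hf
      rw [hφ]
      by_cases h : 0 = k
      · subst h
        exact Submodule.smul_mem _ _ (C.one_mem_gr _)
      -- A multiple of the unit lying in a nonzero degree is zero, hence so is its coefficient.
      · have h1 := A.proj_same hk
        rw [map_smul, A.proj_of_ne h (A.one_mem_gr x), smul_zero] at h1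
        rw [hfree x s h1.symm, zero_smul]
        exact zero_mem _
    · rw [hφne hxy]; exact zero_mem _
  · intro x y f hf
    by_cases hxy : x = y
    · subst hxy
      obtain ⟨s, rfl⟩ := mem_unitSpan_self hf
      rw [hφ, ← A.dLin_apply, ← C.dLin_apply, map_smul, map_smul, A.dLin_apply, C.dLin_apply,
        A.d_one, C.d_one, smul_zero, smul_zero, h0]
    · rw [hφne hxy, hφne hxy, ← C.dLin_apply, map_zero]
  · intro x y f hf
    by_cases hxy : x = y
    · subst hxy
      obtain ⟨s, rfl⟩ := mem_unitSpan_self hf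
      rw [hφ, map_smul, map_smul, hG1]
    · rw [hφne hxy, mem_unitSpan_of_ne hxy hf, map_zero, map_zero]
  · intro x y c hc hl
    cases c with
    | nil => simp [Chain.length] at hl
    | @cons _ z _ f c =>
      -- Only the first entry matters. It is either zero or a multiple of a unit; in the latter case
      -- the unit axioms compute both sides, by `m₂_one` in length two and by vanishing in greater
      -- length.
      by_cases hxz : x = z
      · subst hxz
        obtain ⟨r, rfl⟩ := mem_unitSpan_self hc.1
        have key : φ x y (A.m (.cons (A.one x) c)) = C.m (.cons (C.one (o x)) (c.map o (φ _ _))) ∧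
            A.m (.cons (A.one x) c) ∈ unitSpan A x y :=
          ⟨by
            match c, hl with
            | .cons g .nil, _ =>
              exact (congrArg (φ x _) (A.m₂_one g)).trans (C.m₂_one (φ x _ g)).symm
            | .cons g (.cons g' c), _ =>
              have h1 := A.m_one .nil (.cons g (.cons g' c)) (by simp [Chain.length])
              have h2 := C.m_one .nil ((Chain.cons g (.cons g' c)).map o (φ _ _))
                (by simp [Chain.length, Chain.map])
              simp only [Chain.append] at h1 h2
              rw [h1, h2, h0], hU.m_mem ⟨one_mem_unitSpan x, hc.2⟩⟩
        have h1 : A.m (.cons (r • A.one x) c) = r • A.m (.cons (A.one x) c) :=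
          map_smul (A.slot .nil c) r (A.one x)
        have h2 : C.m (.cons (r • C.one (o x)) (c.map o (φ _ _))) =
            r • C.m (.cons (C.one (o x)) (c.map o (φ _ _))) :=
          map_smul (C.slot .nil (c.map o (φ _ _))) r (C.one (o x))
        rw [h1, Chain.map, hφ, h2, hsmul r key.2, key.1]
      · have h1 : A.m (.cons (0 : A.Hom x z) c) = 0 := map_zero (A.slot .nil c)
        have h2 : C.m (.cons (0 : C.Hom (o x) (o z)) (c.map o (φ _ _))) = 0 :=
          map_zero (C.slot .nil (c.map o (φ _ _)))
        rw [mem_unitSpan_of_ne hxz hc.1, h1, Chain.map, h0, h0, h2]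

/-! ### The union of the stages -/

theorem SemiFreeFiltration.one_mem_stage_zero (fl : SemiFreeFiltration A) (x : A.Obj) :
    A.one x ∈ fl.stage 0 x x :=
  fl.stage_zero ▸ one_mem_unitSpan x

/-- Lifting from one stage of the filtration to the next one. -/
theorem SemiFreeFiltration.exists_isFunctorLift_succ (fl : SemiFreeFiltration A)
    (hG : G.IsQuasiFullyFaithful) (hGs : G.SurjectiveOnMorphisms) (n : ℕ)
    (h1 : ∀ x, A.one x ∈ fl.stage n x x) (h : IsFunctorLift G F (fl.stage n) φ) :
    ∃ χ : ∀ x y : A.Obj, A.Hom x y → C.Hom (o x) (o y), IsFunctorLift G F (fl.stage (n + 1)) χ ∧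
      (∀ x y, fl.stage n x y ≤ fl.stage (n + 1) x y) ∧
      ∀ {x y} {f : A.Hom x y}, f ∈ fl.stage n x y → χ x y f = φ x y f := by
  have := fl.gen_free n
  have hd : ∀ {x y} {f : A.Hom x y}, f ∈ fl.stage n x y ⊔ fl.gen n x y → A.d f ∈ fl.stage n x y :=
    fun {x y f} hf => by
      obtain ⟨s, hs, w, hw, rfl⟩ := Submodule.mem_sup.1 hf
      rw [A.d_add]
      exact add_mem ((fl.stage_sub n).m_mem ⟨hs, trivial⟩) (fl.d_gen n _ _ _ hw)
  obtain ⟨ψ, hψ, hψφ⟩ := exists_isDGLift_sup hG hGs (fl.gen_graded n) (fl.stage_sub n)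
    (fl.disjoint n) (fl.d_gen n) h.toIsDGLift
  obtain ⟨χ, hχ, hle, hχψ⟩ := exists_isFunctorLift_of_generated hψ
    (h.congr (fl.stage_sub n) h1 hψφ) ((fl.stage_sub n).1.sup (fl.gen_graded n)) hd
    (fun _ _ => le_sup_left) h1 (fl.stage_sub (n + 1)) (fl.range_eval n) (fl.ker_eval n)
  exact ⟨χ, hχ, fun x y => le_sup_left.trans (hle x y), fun hf =>
    (hχψ (Submodule.mem_sup_left hf)).trans (hψφ hf)⟩

/-- Lifting from the union of the stages. -/
theorem SemiFreeFiltration.exists_isFunctorLift_top (fl : SemiFreeFiltration A)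
    (hG : G.IsQuasiFullyFaithful) (hGs : G.SurjectiveOnMorphisms)
    (hG1 : ∀ x, G.map (C.one (o x)) = F.map (A.one x)) :
    ∃ φ : ∀ x y : A.Obj, A.Hom x y → C.Hom (o x) (o y), IsFunctorLift G F (fun _ _ => ⊤) φ := by
  classical
  obtain ⟨φ₀, hφ₀⟩ := exists_isFunctorLift_unitSpan (G := G) (F := F)
    (fl.stage_zero ▸ fl.stage_sub 0) fl.one_free hG1
  rw [← fl.stage_zero] at hφ₀
  -- The units are carried along with the lift because the inductive step needs them in the current
  -- stage.
  let X : ℕ → Type _ := fun n => {φ : ∀ x y : A.Obj, A.Hom x y → C.Hom (o x) (o y) //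
    IsFunctorLift G F (fl.stage n) φ ∧ ∀ x, A.one x ∈ fl.stage n x x}
  have step : ∀ n (φ : X n), ∃ χ : X (n + 1), (∀ x y, fl.stage n x y ≤ fl.stage (n + 1) x y) ∧
      ∀ {x y} {f : A.Hom x y}, f ∈ fl.stage n x y → χ.1 x y f = φ.1 x y f := fun n φ => by
    obtain ⟨χ, h, hle, h'⟩ := fl.exists_isFunctorLift_succ hG hGs n φ.2.2 φ.2.1
    exact ⟨⟨χ, h, fun x => hle _ _ (φ.2.2 x)⟩, hle, h'⟩
  choose next hle hnext using step
  let Φ : ∀ n, X n := fun n => Nat.rec ⟨φ₀, hφ₀, fl.one_mem_stage_zero⟩ next n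
  have hmono : ∀ {n m}, n ≤ m → ∀ {x y} {f : A.Hom x y}, f ∈ fl.stage n x y →
      f ∈ fl.stage m x y ∧ (Φ m).1 x y f = (Φ n).1 x y f := by
    intro n m hnm x y f hf
    induction m, hnm using Nat.le_induction with
    | base => exact ⟨hf, rfl⟩
    | succ m _ ih => exact ⟨hle m (Φ m) _ _ ih.1, (hnext m (Φ m) ih.1).trans ih.2⟩
  choose N hN using fl.exhaust
  -- Each morphism is evaluated at some stage containing it; compatibility of the lifts makes the
  -- choice of stage irrelevant.
  let φ : ∀ x y : A.Obj, A.Hom x y → C.Hom (o x) (o y) := fun x y f => (Φ (N x y f)).1 x y f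
  have hφ : ∀ n {x y} {f : A.Hom x y}, f ∈ fl.stage n x y → φ x y f = (Φ n).1 x y f :=
    fun n {x y f} hf => by
      rw [← (hmono (le_max_left n (N x y f)) hf).2,
        (hmono (le_max_right n (N x y f)) (hN x y f)).2]
  have hl : ∀ n, IsFunctorLift G F (fl.stage n) φ := fun n =>
    (Φ n).2.1.congr (fl.stage_sub n) (Φ n).2.2 (hφ n)
  -- A sequence is finite, hence lies in a single stage, where compatibility with the operation is
  -- known.
  have hchain : ∀ {x y} (c : Chain A.Hom x y), ∃ n, c.All fun x y f => f ∈ fl.stage n x y := by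
    intro x y c
    induction c with
    | nil => exact ⟨0, trivial⟩
    | @cons x y z f c ih =>
      obtain ⟨n, hn⟩ := ih
      exact ⟨max n (N x y f), (hmono (le_max_right _ _) (hN x y f)).1,
        hn.mono fun _ _ _ h => (hmono (le_max_left _ _) h).1⟩
  refine ⟨φ, ⟨⟨?_, ?_, ?_, ?_, ?_⟩, ?_, ?_⟩⟩
  · intro x y f g _ _
    exact (hl (max (N x y f) (N x y g))).add (hmono (le_max_left _ _) (hN x y f)).1
      (hmono (le_max_right _ _) (hN x y g)).1
  · intro x y a f _
    exact (hl _).smul a (hN x y f)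
  · intro x y k f _ hk
    exact (hl _).mem_gr (hN x y f) hk
  · intro x y f _
    exact (hl _).map_d (hN x y f)
  · intro x y f _
    exact (hl _).map_eq (hN x y f)
  · intro x y c _ hc
    obtain ⟨n, hn⟩ := hchain c
    exact (hl n).map_m_of_two_le c hn hc
  · exact fun x => (hl 0).map_one x

/-- A strict A∞-functor which is surjective on endomorphisms preserves strict units. -/
theorem StrictFunctor.map_one_of_surjective {B : StrictlyUnitalAInfCat.{u, v'} R}
    (G : StrictFunctor C.toAInfCat B.toAInfCat) (x : C.Obj)
    (hG : Function.Surjective (G.map : C.Hom x x → B.Hom (G.obj x) (G.obj x))) :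
    G.map (C.one x) = B.one (G.obj x) := by
  -- With `e` over the unit of `B`, the equation `m²(e, 1) = e` in `C` maps to `m²(1, G 1) = 1`,
  -- whose left side is `G 1` because `G 1` has degree zero.
  obtain ⟨e, he⟩ := hG (B.one (G.obj x))
  have h1 : B.m₂ (G.map e) (G.map (C.one x)) = G.map e :=
    (G.map_m _).symm.trans (congrArg G.map (C.m₂_one e))
  rw [he, B.one_m₂ 0 _ (G.map_mem_gr 0 _ (C.one_mem_gr x))] at h1
  simpa using h1

end Lifts

end AInf

end

theorem lemmaD {R : Type u} [CommRing R]
    (A : AInf.StrictlyUnitalAInfCat.{u, v₁} R)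
    (B : AInf.StrictlyUnitalAInfCat.{u, v₂} R)
    (C : AInf.StrictlyUnitalAInfCat.{u, v₃} R)
    (hA : AInf.IsSemiFree A)
    (F : AInf.StrictFunctor A.toAInfCat B.toAInfCat) (hF : F.IsStrictlyUnital)
    (G : AInf.StrictFunctor C.toAInfCat B.toAInfCat) (hG : G.IsQuasiEquivalence)
    (hGsurj : G.SurjectiveOnMorphisms) :
    ∃ F' : AInf.StrictFunctor A.toAInfCat C.toAInfCat, F'.IsStrictlyUnital ∧ G.comp F' = F := by
  obtain ⟨fl⟩ := hA
  obtain ⟨Fobj, Fmap, Fgr, Fm⟩ := F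
  obtain ⟨o, ho⟩ : ∃ o : A.Obj → C.Obj, Fobj = fun x => G.obj (o x) := by
    choose o ho using fun x => hGsurj.1 (Fobj x)
    exact ⟨o, funext fun x => (ho x).symm⟩
  -- The object map of `F` becomes literally the composite of `G.obj` and `o`, so values of `F` and
  -- of `G` lie in the same Hom-modules and no transport is needed.
  subst ho
  let F₀ : AInf.FunctorOver A.toAInfCat B.toAInfCat fun x => G.obj (o x) := ⟨Fmap, Fgr, Fm⟩
  obtain ⟨φ, hφ⟩ := fl.exists_isFunctorLift_top (G := G) (F := F₀) hG.1 hGsurj fun x =>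
    (G.map_one_of_surjective (o x) (hGsurj.2 _ _)).trans (hF x).symm
  refine ⟨{ obj := o
            map := fun {x y} =>
              { toFun := φ x y
                map_add' := fun f g => hφ.add trivial trivial
                map_smul' := fun a f => hφ.smul a trivial }
            map_mem_gr := fun k f hf => hφ.mem_gr trivial hf
            map_m := fun c => hφ.map_m c (AInf.Chain.all_of_forall (fun _ _ _ => trivial) c) },
    hφ.map_one, ?_⟩
  have h : (fun {x y : A.Obj} => G.map ∘ₗ (⟨⟨φ x y, fun f g => hφ.add trivial trivial⟩,
      fun a f => hφ.smul a trivial⟩ : A.Hom x y →ₗ[R] C.Hom (o x) (o y))) = @Fmap := by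
    funext x y
    exact LinearMap.ext fun f => hφ.map_eq trivial
  simp only [AInf.StrictFunctor.comp]
  congr 1
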